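/- Let $N\ge 3$ and $\mathcal A=\{1,\dots,N\}$ be a set of actors, and let $\mathcal O=\{-1,+1\}$ be the set of opinions. A list of social pressures is an element of $\mathcal S=\{u\in\mathbb Z^{\mathcal A}:\min_{a}|u(a)|=0\}$. For $a\in\mathcal A$ and $o\in\mathcal O$ let $\pi^{a,o}(u)$ be the list with $\pi^{a,o}(u)(a)=0$ and $\pi^{a,o}(u)(b)=u(b)+o$ for $b\ne a$. For $\beta\ge 0$ and $u\in\mathcal S$ let $(U^{\beta,u}_t)_{t\ge 0}$ be the Markov jump process on $\mathcal S$ that starts at $u$ and jumps from a list $w$ to $\pi^{a,o}(w)$ at rate $\exp(\beta\, o\, w(a))$: at each newly reached list $w$, independent exponential random times with parameters $\exp(\beta\, o\, w(a))$, $(a,o)\in\mathcal A\times\mathcal O$, are started, and the pair $(a,o)$ whose time occurs first determines the time of the next jump and the next list $\pi^{a,o}(w)$. Let $\mathcal C^+=\{u\in\mathcal S:u\ne\vec 0,\ u(a)\ge 0\text{ for all }a\}$, let $\mathcal C^-=\{u\in\mathcal S:u\ne\vec 0,\ u(a)\le 0\text{ for all }a\}$, and for $B\subset\mathcal S$ let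 $R^{\beta,u}(B)=\inf\{t>0:U^{\beta,u}_t\in B\}$ (with $\inf\emptyset=+\infty$). Theorem. For every $v\in\mathcal C^+$, one has $0<\mathbb E[R^{\beta,v}(\mathcal C^-)]<\infty$ for all $\beta\ge 0$, and $$\frac{R^{\beta,v}(\mathcal C^-)}{\mathbb E[R^{\beta,v}(\mathcal C^-)]}\longrightarrow \mathrm{Exp}(1)\quad\text{in distribution, as }\beta\to+\infty,$$ where $\mathrm{Exp}(1)$ denotes the exponential distribution with mean $1$. -/

import Mathlib

open MeasureTheory ProbabilityTheory Filter
open scoped ENNReal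

namespace SocialNetwork

/-- A list of social pressures: one integer for each of the `N` actors. -/
abbrev PressureList (N : ℕ) : Type := Fin N → ℤ

/-- A pair (actor, opinion). The opinions are the two units `1` and `-1` of `ℤ`. -/
abbrev Mark (N : ℕ) : Type := Fin N × ℤˣ

/-- The state space: the lists in which some actor has null pressure,
that is `min {|u a| : a} = 0`. -/
def states (N : ℕ) : Set (PressureList N) := {u | ∃ a, u a = 0}

/-- The positive consensus lists. -/
def positiveConsensus (N : ℕ) : Set (PressureList N) :=
  {u | u ∈ states N ∧ u ≠ 0 ∧ ∀ a, 0 ≤ u a}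

/-- The negative consensus lists. -/
def negativeConsensus (N : ℕ) : Set (PressureList N) :=
  {u | u ∈ states N ∧ u ≠ 0 ∧ ∀ a, u a ≤ 0}

/-- The list after actor `p.1` has expressed opinion `p.2`: the pressure on this actor is reset
to `0`, and the opinion is added to the pressure on every other actor. -/
def express {N : ℕ} (p : Mark N) (u : PressureList N) : PressureList N :=
  fun b => if b = p.1 then 0 else u b + (p.2 : ℤ)

/-- The rate `exp (β o u(a))` at which actor `a` expresses opinion `o` when the list is `u`. -/
noncomputable def rate {N : ℕ} (β : ℝ) (u : PressureList N) (p : Mark N) : ℝ :=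
  Real.exp (β * (((p.2 : ℤ) : ℝ)) * (u p.1 : ℝ))

/-- Sample points: `ω (n, p)` is the value of the unit exponential variable from which the clock of
the pair `p` is made after the `n`-th opinion. -/
abbrev Sample (N : ℕ) : Type := ℕ × Mark N → ℝ

instance isProbabilityMeasure_expMeasure_one : IsProbabilityMeasure (expMeasure 1) :=
  isProbabilityMeasure_expMeasure one_pos

/-- The law of a family of independent exponential variables of parameter `1`. -/
noncomputable def law (N : ℕ) : Measure (Sample N) :=
  Measure.infinitePi fun _ : ℕ × Mark N => expMeasure 1

instance isProbabilityMeasure_law (N : ℕ) : IsProbabilityMeasure (law N) := by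
  unfold law; infer_instance

/-- The exponential times attached to the pairs (actor, opinion) after the `n`-th opinion, when
the current list is `u`. They are independent, and the one of `p` has parameter `rate β u p`,
being an exponential variable of parameter `1` divided by this number. -/
noncomputable def clock {N : ℕ} (β : ℝ) (n : ℕ) (u : PressureList N) (ω : Sample N) (p : Mark N) :
    ℝ :=
  ω (n, p) / rate β u p

/-- The pair whose exponential time occurs first (ties have probability zero). -/
noncomputable def firstMark {N : ℕ} [NeZero N] (e : Mark N → ℝ) : Mark N :=
  Classical.epsilon fun p => ∀ q, e p ≤ e q

variable {N : ℕ} [NeZero N]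

/-- The embedded chain: the list of social pressures after the `n`-th opinion, starting at `u`. -/
noncomputable def chain (β : ℝ) (u : PressureList N) (ω : Sample N) : ℕ → PressureList N
  | 0 => u
  | n + 1 => express (firstMark (clock β n (chain β u ω n) ω)) (chain β u ω n)

/-- The pair (actor, opinion) of the `(n + 1)`-st opinion. -/
noncomputable def mark (β : ℝ) (u : PressureList N) (ω : Sample N) (n : ℕ) : Mark N :=
  firstMark (clock β n (chain β u ω n) ω)

/-- The time of the `n`-th opinion, with time `0` for `n = 0`. -/
noncomputable def jumpTime (β : ℝ) (u : PressureList N) (ω : Sample N) : ℕ → ℝ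
  | 0 => 0
  | n + 1 => jumpTime β u ω n + clock β n (chain β u ω n) ω (mark β u ω n)

open Classical in
/-- The list of social pressures at time `t`: it is the list after the `m`-th opinion if `t` lies
between the `m`-th and the `(m + 1)`-st opinion. The value `none` means that no such `m` exists,
which for `0 ≤ t` happens only at or after an explosion. -/
noncomputable def pressureAt (β : ℝ) (u : PressureList N) (t : ℝ) (ω : Sample N) :
    Option (PressureList N) :=
  if h : ∃ m, jumpTime β u ω m ≤ t ∧ t < jumpTime β u ω (m + 1) then
    some (chain β u ω (Nat.find h))
  else none

/-- The reaching time `inf {t > 0 : U_t ∈ B}` of a set `B` of lists, infinite if `B` is never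
reached. -/
noncomputable def reachingTime (β : ℝ) (u : PressureList N) (B : Set (PressureList N))
    (ω : Sample N) : ℝ≥0∞ :=
  ⨅ (t : ℝ) (_ : 0 < t ∧ ∃ w ∈ B, pressureAt β u t ω = some w), ENNReal.ofReal t

/-- The expectation of the reaching time. -/
noncomputable def meanReachingTime (β : ℝ) (u : PressureList N) (B : Set (PressureList N)) : ℝ≥0∞ :=
  ∫⁻ ω, reachingTime β u B ω ∂(law N)

end SocialNetwork

/-!
The reaching time of the negative consensus is a hitting time of a Markov jump process, so its mean
`h u` and its characteristic function `f u`, as functions of the initial list `u`, satisfy the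
one-step equations recorded in `IsHittingMean` and `IsHittingCharFun`. The limit theorem is deduced
from these equations alone, by comparison with subharmonic functions (`le_of_le_avg`).

* *Fast return.* A move of greatest rate has probability at least `1 / (2 N)`, whatever `β ≥ 0` is,
  and from every list some `3 N` such moves lead to a *ladder*, a list with the pressures
  `0, 1, …, N - 1`, or to a negative consensus (`reaches_ladder_union`). Hence the mean time to
  reach these sets is bounded uniformly in `u` and `β`. By symmetry under permutations of the
  actors, `h` and `f` are constant on the ladders, with values `m` and `φ`.
* *Slow escape.* The function `escape h u = 1 - h u / m` is, up to `O(1 / m)`, the probability of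
  reaching the negative consensus from `u` before the ladders. As long as only positive opinions
  are expressed from a ladder, the pressures stay distinct, so that some pressure is at least
  `N - 1`. A negative opinion then has probability `O(exp (-β (N - 1)))`, and it either costs
  another factor `exp (-β)` or leaves a nonnegative list, from which the escape probability is
  `O(exp (-β))`. Since the mean holding time at a ladder is of the order of `exp (-β (N - 1))`, it
  follows that `1 / m = O(exp (-β))` (`IsHittingMean.one_div_le`).
* *Exponential limit.* By the fast return, `|f u - φ| ≤ 2 escape h u + O(θ + 1 / m)`. The process
  spends most of its time at lists with small `escape h`, because from the other lists it
  reaches the negative consensus before the ladders with a probability that is not small. Since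
  `1 - f` is `-i θ` times the expected integral of `f` along the path up to the hitting time, this
  gives `1 - φ ≈ -i θ m φ` (`IsHittingCharFun.norm_one_sub_add_le`), that is `φ → 1 / (1 - i s)`
  if `θ m → s`. From a positive consensus a ladder is reached first with probability close to `1`,
  so that `h v / m → 1` and `f v - φ → 0`, and Lévy's continuity theorem concludes.

The one-step equations come from the Markov property at the first opinion
(`measurePreserving_firstStep`): the first mark, the time until it occurs and the shifted sample
are independent, the time being exponential with the total rate as parameter. The one for `h`
requires that `h` is finite; this follows from a bound on the means of truncated hitting times, by
the same comparison. The process cannot explode before the negative consensus is reached, because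
almost surely this takes finitely many opinions (`ae_hits`).
-/

namespace SocialNetwork

variable {N : ℕ}

/-! ### The transition probabilities and the maximum principle -/

/-- The total jump rate out of the list `u`. -/
noncomputable def totalRate (β : ℝ) (u : PressureList N) : ℝ := ∑ p, rate β u p

/-- The probability that the next opinion after the list `u` is the pair `p`. -/
noncomputable def jumpProb (β : ℝ) (u : PressureList N) (p : Mark N) : ℝ :=
  rate β u p / totalRate β u

/-- The transition operator of the embedded chain. -/
noncomputable def avg {E : Type*} [AddCommGroup E] [Module ℝ E] (β : ℝ) (g : PressureList N → E)
    (u : PressureList N) : E :=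
  ∑ p, jumpProb β u p • g (express p u)

/-- The pair `p` has the greatest exponent `o * u a`, so that for `0 ≤ β` no pair has a greater
rate. -/
def IsMaximal (u : PressureList N) (p : Mark N) : Prop :=
  ∀ q : Mark N, (q.2 : ℤ) * u q.1 ≤ (p.2 : ℤ) * u p.1

/-- The set `B` can be reached from `u` by at most `n` moves, each of them allowed by `A`. -/
inductive Reaches (A : PressureList N → Mark N → Prop) (B : Set (PressureList N)) :
    ℕ → PressureList N → Prop
  | done {n : ℕ} {u : PressureList N} : u ∈ B → Reaches A B n u
  | step {n : ℕ} {u : PressureList N} (p : Mark N) :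
      A u p → Reaches A B n (express p u) → Reaches A B (n + 1) u

lemma Reaches.mono {A A' : PressureList N → Mark N → Prop} {B : Set (PressureList N)} {n m : ℕ}
    {u : PressureList N} (h : Reaches A B n u) (hA : ∀ u p, A u p → A' u p) (hnm : n ≤ m) :
    Reaches A' B m u := by
  induction h generalizing m with
  | done hu => exact .done hu
  | step p hp _ ih =>
    obtain ⟨k, rfl⟩ := Nat.exists_eq_add_of_le' (Nat.one_le_of_lt hnm)
    exact .step p (hA _ _ hp) (ih (by omega))

lemma Reaches.trans {A : PressureList N → Mark N → Prop} {B B' : Set (PressureList N)} {n m : ℕ}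
    {u : PressureList N} (h : Reaches A B n u) (hB : ∀ w ∈ B, Reaches A B' m w) :
    Reaches A B' (n + m) u := by
  induction h with
  | done hu => exact (hB _ hu).mono (fun _ _ h => h) (by omega)
  | @step n u p hp _ ih =>
    rw [Nat.add_right_comm]
    exact .step p hp ih

lemma rate_pos (β : ℝ) (u : PressureList N) (p : Mark N) : 0 < rate β u p := Real.exp_pos _

lemma rate_eq (β : ℝ) (u : PressureList N) (p : Mark N) :
    rate β u p = Real.exp (β * (((p.2 : ℤ) * u p.1 : ℤ) : ℝ)) := by
  unfold rate; push_cast; ring_nf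

lemma rate_le_totalRate (β : ℝ) (u : PressureList N) (p : Mark N) :
    rate β u p ≤ totalRate β u :=
  Finset.single_le_sum (f := rate β u) (fun q _ => (rate_pos β u q).le) (Finset.mem_univ p)

lemma jumpProb_nonneg (β : ℝ) (u : PressureList N) (p : Mark N) : 0 ≤ jumpProb β u p :=
  div_nonneg (rate_pos β u p).le (Finset.sum_nonneg fun q _ => (rate_pos β u q).le)

lemma card_mark : (Fintype.card (Mark N) : ℝ) = 2 * N := by
  simp [Mark, mul_comm]

lemma avg_mono {β : ℝ} {g g' : PressureList N → ℝ} {u : PressureList N} (h : ∀ w, g w ≤ g' w) :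
    avg β g u ≤ avg β g' u :=
  Finset.sum_le_sum fun p _ => smul_le_smul_of_nonneg_left (h _) (jumpProb_nonneg β u p)

lemma avg_add {E : Type*} [AddCommGroup E] [Module ℝ E] (β : ℝ) (g g' : PressureList N → E)
    (u : PressureList N) : avg β (fun w => g w + g' w) u = avg β g u + avg β g' u := by
  simp [avg, Finset.sum_add_distrib]

lemma avg_sub {E : Type*} [AddCommGroup E] [Module ℝ E] (β : ℝ) (g g' : PressureList N → E)
    (u : PressureList N) : avg β (fun w => g w - g' w) u = avg β g u - avg β g' u := by
  simp [avg, Finset.sum_sub_distrib, smul_sub]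

lemma avg_const_mul {𝕜 : Type*} [Ring 𝕜] [Algebra ℝ 𝕜] (β : ℝ) (a : 𝕜) (g : PressureList N → 𝕜)
    (u : PressureList N) : avg β (fun w => a * g w) u = a * avg β g u := by
  simp [avg, Finset.mul_sum]

lemma norm_avg_le {E : Type*} [NormedAddCommGroup E] [NormedSpace ℝ E] (β : ℝ)
    (g : PressureList N → E) (u : PressureList N) : ‖avg β g u‖ ≤ avg β (fun w => ‖g w‖) u := by
  refine (norm_sum_le _ _).trans (Finset.sum_le_sum fun p _ => ?_)
  rw [norm_smul, Real.norm_of_nonneg (jumpProb_nonneg β u p), smul_eq_mul]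

lemma totalRate_le {β : ℝ} (hβ : 0 ≤ β) {u : PressureList N} {k : ℤ}
    (h : ∀ p : Mark N, (p.2 : ℤ) * u p.1 ≤ k) :
    totalRate β u ≤ 2 * N * Real.exp (β * k) := by
  calc totalRate β u ≤ ∑ _p : Mark N, Real.exp (β * k) := by
        refine Finset.sum_le_sum fun p _ => ?_
        rw [rate_eq]
        exact Real.exp_le_exp.2 (mul_le_mul_of_nonneg_left (by exact_mod_cast h p) hβ)
    _ = _ := by rw [Finset.sum_const, nsmul_eq_mul, Finset.card_univ, card_mark]

variable [NeZero N]

lemma totalRate_pos (β : ℝ) (u : PressureList N) : 0 < totalRate β u :=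
  (rate_pos β u (0, 1)).trans_le (rate_le_totalRate β u _)

lemma one_le_totalRate {β : ℝ} (hβ : 0 ≤ β) (u : PressureList N) : 1 ≤ totalRate β u := by
  rcases le_total 0 (u 0) with h | h
  · refine le_trans ?_ (rate_le_totalRate β u (0, 1))
    rw [rate_eq]
    refine Real.one_le_exp (mul_nonneg hβ ?_)
    simpa using h
  · refine le_trans ?_ (rate_le_totalRate β u (0, -1))
    rw [rate_eq]
    refine Real.one_le_exp (mul_nonneg hβ ?_)
    simpa using h

lemma sum_jumpProb (β : ℝ) (u : PressureList N) : ∑ p, jumpProb β u p = 1 := by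
  unfold jumpProb
  rw [← Finset.sum_div]
  exact div_self (totalRate_pos β u).ne'

lemma IsMaximal.le_jumpProb {β : ℝ} (hβ : 0 ≤ β) {u : PressureList N} {p : Mark N}
    (hp : IsMaximal u p) : 1 / (2 * N : ℝ) ≤ jumpProb β u p := by
  have hN : (0 : ℝ) < N := by exact_mod_cast NeZero.pos N
  have h := totalRate_le hβ hp
  rw [← rate_eq] at h
  unfold jumpProb
  rw [div_le_div_iff₀ (by positivity) (totalRate_pos β u)]
  linarith

lemma jumpProb_le {β : ℝ} (hβ : 0 ≤ β) {u : PressureList N} {p q : Mark N} {k : ℤ}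
    (h : (q.2 : ℤ) * u q.1 + k ≤ (p.2 : ℤ) * u p.1) : jumpProb β u q ≤ Real.exp (-(β * k)) := by
  unfold jumpProb
  rw [div_le_iff₀ (totalRate_pos β u)]
  refine le_trans ?_ (mul_le_mul_of_nonneg_left (rate_le_totalRate β u p) (Real.exp_pos _).le)
  rw [rate_eq, rate_eq, ← Real.exp_add]
  refine Real.exp_le_exp.2 ?_
  have : (((q.2 : ℤ) * u q.1 : ℤ) : ℝ) + k ≤ (((p.2 : ℤ) * u p.1 : ℤ) : ℝ) := by exact_mod_cast h
  nlinarith [mul_le_mul_of_nonneg_left this hβ]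

lemma avg_const {E : Type*} [AddCommGroup E] [Module ℝ E] (β : ℝ) (a : E)
    (u : PressureList N) : avg β (fun _ => a) u = a := by
  rw [avg, ← Finset.sum_smul, sum_jumpProb, one_smul]

/-- Maximum principle. A bounded function that is nonpositive on `B` and is subharmonic up to `δ`
off `B` is small everywhere, provided that `B` can be reached from every list by at most `K` moves
of probability at least `c`. -/
lemma le_of_le_avg {β δ c : ℝ} {K : ℕ} {B : Set (PressureList N)} {g : PressureList N → ℝ}
    (hc : 0 < c) (hc1 : c ≤ 1) (hδ : 0 ≤ δ)
    (hreach : ∀ u, Reaches (fun u p => c ≤ jumpProb β u p) B K u)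
    (hbdd : BddAbove (Set.range g)) (hB : ∀ u ∈ B, g u ≤ 0)
    (hstep : ∀ u ∉ B, g u ≤ δ + avg β g u) (u : PressureList N) :
    g u ≤ K * δ / c ^ K := by
  set M := max (⨆ w, g w) 0
  have hM0 : 0 ≤ M := le_max_right _ _
  have hM : ∀ w, g w ≤ M := fun w => (le_ciSup hbdd w).trans (le_max_left _ _)
  have key : ∀ n u, Reaches (fun u p => c ≤ jumpProb β u p) B n u →
      g u ≤ n * δ + (1 - c ^ n) * M := by
    intro n u h
    induction h with
    | @done n u hu =>
      refine (hB u hu).trans ?_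
      have : c ^ n ≤ 1 := pow_le_one₀ hc.le hc1
      have : 0 ≤ (1 - c ^ n) * M := mul_nonneg (by linarith) hM0
      positivity
    | @step n u p hp _ ih =>
      by_cases hu : u ∈ B
      · refine (hB u hu).trans ?_
        have : c ^ (n + 1) ≤ 1 := pow_le_one₀ hc.le hc1
        have : 0 ≤ (1 - c ^ (n + 1)) * M := mul_nonneg (by linarith) hM0
        positivity
      set X := n * δ + (1 - c ^ n) * M
      have h1 : avg β g u ≤ M + jumpProb β u p * (X - M) := by
        calc avg β g u ≤ ∑ q, (jumpProb β u q * M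
              + if q = p then jumpProb β u q * (X - M) else 0) := by
              refine Finset.sum_le_sum fun q _ => ?_
              rw [smul_eq_mul]
              split_ifs with hq
              · subst hq
                have := mul_le_mul_of_nonneg_left ih (jumpProb_nonneg β u q)
                linarith
              · rw [add_zero]
                exact mul_le_mul_of_nonneg_left (hM _) (jumpProb_nonneg β u q)
          _ = _ := by
              rw [Finset.sum_add_distrib, ← Finset.sum_mul, sum_jumpProb]
              simp
      have hp1 : jumpProb β u p ≤ 1 := by
        rw [← sum_jumpProb β u]
        exact Finset.single_le_sum (f := jumpProb β u) (fun q _ => jumpProb_nonneg β u q)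
          (Finset.mem_univ p)
      have h2 := hstep u hu
      have hcn : c ^ (n + 1) ≤ c ^ n := pow_le_pow_of_le_one hc.le hc1 (Nat.le_succ n)
      have h3 : c ^ (n + 1) * M ≤ c ^ n * M := mul_le_mul_of_nonneg_right hcn hM0
      push_cast
      rcases le_total M X with hX | hX
      · have : jumpProb β u p * (X - M) ≤ 1 * (X - M) :=
          mul_le_mul_of_nonneg_right hp1 (by linarith)
        have hXd : X = n * δ + (1 - c ^ n) * M := rfl
        nlinarith
      · have h4 : jumpProb β u p * (X - M) ≤ c * (X - M) :=
          mul_le_mul_of_nonpos_right hp (by linarith)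
        have h5 : c * (X - M) = c * (n * δ) - c ^ (n + 1) * M := by
          simp only [X]; ring
        have h6 : c * (n * δ) ≤ 1 * (n * δ) := mul_le_mul_of_nonneg_right hc1 (by positivity)
        nlinarith
  have hcK : 0 < c ^ K := pow_pos hc K
  have hMle : M ≤ K * δ / c ^ K := by
    rw [le_div_iff₀ hcK]
    rcases max_cases (⨆ w, g w) 0 with ⟨h, _⟩ | ⟨h, _⟩
    · have : M ≤ K * δ + (1 - c ^ K) * M := by
        conv_lhs => rw [show M = ⨆ w, g w from h]
        exact ciSup_le fun w => key K w (hreach w)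
      linarith
    · rw [show M = 0 from h, zero_mul]; positivity
  exact (hM u).trans hMle

end SocialNetwork

namespace SocialNetwork

variable {N : ℕ}

/-! ### Paths of maximal moves -/

/-- The ladder lists: the pressures are `0, 1, …, N - 1` in some order. -/
def ladder (N : ℕ) : Set (PressureList N) :=
  {u | Function.Injective u ∧ ∀ a, 0 ≤ u a ∧ u a < N}

/-- The nonnegative lists in which `s` actors have distinct pressures below `s`, all others having
pressure at least `s`. Every nonnegative list is of this form for `s = 0`, and for `s = N` these
are the ladder lists. -/
def ladderStage (N s : ℕ) : Set (PressureList N) :=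
  {u | ∃ T : Finset (Fin N), T.card = s ∧ (∀ a ∈ T, 0 ≤ u a ∧ u a < s) ∧ Set.InjOn u T ∧
    ∀ b ∉ T, (s : ℤ) ≤ u b}

@[simp] lemma express_self (p : Mark N) (u : PressureList N) : express p u p.1 = 0 := by
  simp [express]

lemma express_of_ne {p : Mark N} {u : PressureList N} {b : Fin N} (h : b ≠ p.1) :
    express p u b = u b + (p.2 : ℤ) := by
  simp [express, h]

lemma nonneg_of_mem_ladderStage {s : ℕ} {u : PressureList N} (hu : u ∈ ladderStage N s)
    (a : Fin N) : 0 ≤ u a := by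
  obtain ⟨T, -, h1, -, h2⟩ := hu
  by_cases ha : a ∈ T
  · exact (h1 a ha).1
  · exact le_trans (by positivity) (h2 a ha)

lemma mem_ladderStage_zero {u : PressureList N} (hu : ∀ a, 0 ≤ u a) : u ∈ ladderStage N 0 :=
  ⟨∅, by simp, by simp, by simp, by simpa using hu⟩

lemma mem_ladder_of_mem_ladderStage {u : PressureList N} (hu : u ∈ ladderStage N N) :
    u ∈ ladder N := by
  obtain ⟨T, hT, h1, h2, -⟩ := hu
  have : T = Finset.univ := by
    rw [← Finset.card_eq_iff_eq_univ, hT, Fintype.card_fin]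
  subst this
  exact ⟨by simpa using h2, fun a => h1 a (Finset.mem_univ a)⟩

lemma units_coe_cases (o : ℤˣ) : o = 1 ∧ (o : ℤ) = 1 ∨ o = -1 ∧ (o : ℤ) = -1 := by
  rcases Int.units_eq_one_or o with rfl | rfl <;> simp

/-- A maximal move has the greatest absolute pressure, with its sign. -/
lemma IsMaximal.abs_le {u : PressureList N} {p : Mark N} (hp : IsMaximal u p) (a : Fin N) :
    |u a| ≤ (p.2 : ℤ) * u p.1 := by
  have h1 := hp (a, 1)
  have h2 := hp (a, -1)
  simp only [Units.val_one, one_mul, Units.val_neg, neg_mul] at h1 h2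
  exact _root_.abs_le.2 ⟨by linarith, h1⟩

lemma IsMaximal.abs_eq {u : PressureList N} {p : Mark N} (hp : IsMaximal u p) :
    (p.2 : ℤ) * u p.1 = |u p.1| := by
  have h := hp.abs_le p.1
  rcases units_coe_cases p.2 with ⟨-, h2⟩ | ⟨-, h2⟩ <;> rw [h2] at h ⊢
  · linarith [le_abs_self (u p.1)]
  · linarith [neg_le_abs (u p.1)]

lemma exists_isMaximal [NeZero N] (u : PressureList N) : ∃ p, IsMaximal u p := by
  obtain ⟨p, -, hp⟩ := Finset.exists_max_image (Finset.univ : Finset (Mark N))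
    (fun p => (p.2 : ℤ) * u p.1) ⟨(0, 1), Finset.mem_univ _⟩
  exact ⟨p, fun q => hp q (Finset.mem_univ q)⟩

lemma IsMaximal.eq_one {u : PressureList N} {p : Mark N} (hp : IsMaximal u p)
    (hu : ∀ a, 0 ≤ u a) (hu0 : u ≠ 0) : p.2 = 1 := by
  rcases units_coe_cases p.2 with ⟨h, -⟩ | ⟨-, h⟩
  · exact h
  · exfalso
    apply hu0
    funext a
    have h1 := hp.abs_le a
    rw [h] at h1
    have h2 := hu p.1
    have h3 : |u a| ≤ 0 := by linarith
    simpa using h3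

lemma express_mem_ladderStage {s : ℕ} {u : PressureList N} {a : Fin N}
    (hu : u ∈ ladderStage N s) (hs : s < N) (ha : ∀ b, u b ≤ u a) :
    express (a, 1) u ∈ ladderStage N (s + 1) := by
  obtain ⟨T, hT, h1, h2, h3⟩ := hu
  have haT : a ∉ T := by
    intro haT
    obtain ⟨b, hb⟩ : ∃ b, b ∉ T := by
      by_contra! h
      have hcard : (Finset.univ : Finset (Fin N)).card = s := Finset.eq_univ_iff_forall.2 h ▸ hT
      rw [Finset.card_univ, Fintype.card_fin] at hcard
      omega
    have := h1 a haT
    have := h3 b hb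
    have := ha b
    omega
  have hne : ∀ {b}, b ∈ T → b ≠ a := fun hb h => haT (h ▸ hb)
  have hval : ∀ {b}, b ≠ a → express (a, 1) u b = u b + 1 := fun {b} hb => by
    rw [express_of_ne (p := (a, 1)) hb]; simp
  have hval0 : express (a, 1) u a = 0 := express_self (a, 1) u
  refine ⟨insert a T, by rw [Finset.card_insert_of_notMem haT, hT], ?_, ?_, ?_⟩
  · intro b hb
    rcases Finset.mem_insert.1 hb with rfl | hb
    · rw [hval0]; exact ⟨le_rfl, by positivity⟩
    · rw [hval (hne hb)]; have := h1 b hb; push_cast; omega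
  · intro b hb b' hb' h
    rw [Finset.mem_coe, Finset.mem_insert] at hb hb'
    rcases hb with rfl | hb <;> rcases hb' with rfl | hb'
    · rfl
    · rw [hval0, hval (hne hb')] at h; have := h1 b' hb'; omega
    · rw [hval0, hval (hne hb)] at h; have := h1 b hb; omega
    · rw [hval (hne hb), hval (hne hb')] at h
      exact h2 hb hb' (by omega)
  · intro b hb
    rw [Finset.mem_insert, not_or] at hb
    rw [hval hb.1]; have := h3 b hb.2; push_cast; omega

lemma express_one_ne_zero (hN : 2 ≤ N) {u : PressureList N} (hu : ∀ a, 0 ≤ u a) (a : Fin N) :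
    express (a, 1) u ≠ 0 := by
  intro h
  obtain ⟨b, hb⟩ : ∃ b : Fin N, b ≠ a := by
    have : Nontrivial (Fin N) := Fin.nontrivial_iff_two_le.2 hN
    exact exists_ne a
  have := congrFun h b
  rw [express_of_ne (p := (a, 1)) hb] at this
  have := hu b
  simp at *
  omega

/-- A negative opinion turns nonpositive pressures into a negative consensus. -/
lemma express_neg_mem_negativeConsensus (hN : 2 ≤ N) {u : PressureList N} (hu : ∀ a, u a ≤ 0)
    {p : Mark N} (hp : p.2 = -1) : express p u ∈ negativeConsensus N := by
  refine ⟨⟨p.1, by simp⟩, fun h => ?_, fun a => ?_⟩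
  · obtain ⟨b, hb⟩ : ∃ b : Fin N, b ≠ p.1 := by
      have : Nontrivial (Fin N) := Fin.nontrivial_iff_two_le.2 hN
      exact exists_ne p.1
    have := congrFun h b
    rw [express_of_ne hb, hp] at this
    have := hu b
    simp at *
    omega
  · by_cases hap : a = p.1
    · rw [hap, express_self]
    · rw [express_of_ne hap, hp]
      have := hu a
      simp
      omega

variable [NeZero N]

lemma reaches_ladder_of_mem_ladderStage (n : ℕ) {s : ℕ} (hs : s + n = N) {u : PressureList N}
    (hu : u ∈ ladderStage N s) : Reaches IsMaximal (ladder N) n u := by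
  induction n generalizing s u with
  | zero =>
    obtain rfl : s = N := by omega
    exact .done (mem_ladder_of_mem_ladderStage hu)
  | succ n ih =>
    obtain ⟨a, ha⟩ := Finite.exists_max u
    have hnn := nonneg_of_mem_ladderStage hu
    refine .step (a, 1) (fun q => ?_)
      (ih (s := s + 1) (by omega) (express_mem_ladderStage hu (by omega) ha))
    have h1 := ha q.1
    have h2 := hnn q.1
    rcases units_coe_cases q.2 with ⟨-, h⟩ | ⟨-, h⟩ <;> rw [h] <;> simp <;> linarith

/-- From a nonnegative list, `N` maximal moves build a ladder. -/
lemma reaches_ladder {u : PressureList N} (hu : ∀ a, 0 ≤ u a) :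
    Reaches IsMaximal (ladder N) N u :=
  reaches_ladder_of_mem_ladderStage N (s := 0) (by omega) (mem_ladderStage_zero hu)

/-- The set `T` consists of `s` actors with small pressures. A maximal move either comes from an
actor outside `T`, who then joins `T`, or shows that all pressures are small. -/
lemma reaches_bounded_aux (n : ℕ) {s : ℕ} (hs : s + n = N) {u : PressureList N}
    (T : Finset (Fin N)) (hT : T.card = s) (hu : ∀ a ∈ T, |u a| ≤ s) :
    Reaches IsMaximal {u | ∀ a, |u a| ≤ N} n u := by
  induction n generalizing s u T with
  | zero =>
    refine .done fun a => ?_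
    obtain rfl : s = N := by omega
    have : T = Finset.univ := by
      rw [← Finset.card_eq_iff_eq_univ, hT, Fintype.card_fin]
    exact hu a (this ▸ Finset.mem_univ a)
  | succ n ih =>
    obtain ⟨p, hp⟩ := exists_isMaximal u
    by_cases hpT : p.1 ∈ T
    · refine .done fun a => (hp.abs_le a).trans ?_
      rw [hp.abs_eq]
      have := hu _ hpT
      omega
    · refine .step p hp (ih (s := s + 1) (by omega) (insert p.1 T)
        (by rw [Finset.card_insert_of_notMem hpT, hT]) fun a ha => ?_)
      by_cases hap : a = p.1
      · rw [hap, express_self]; simp; omega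
      · have h1 := hu a ((Finset.mem_insert.1 ha).resolve_left hap)
        rw [express_of_ne hap]
        refine (abs_add_le _ _).trans ?_
        rcases units_coe_cases p.2 with ⟨-, h⟩ | ⟨-, h⟩ <;> rw [h] <;> simp <;> exact h1

lemma reaches_bounded (u : PressureList N) : Reaches IsMaximal {u | ∀ a, |u a| ≤ N} N u :=
  reaches_bounded_aux N (s := 0) (by omega) ∅ (by simp) (by simp)

/-- Each maximal move lowers the smaller one of the greatest positive and the greatest negative
pressure, so that the signs agree in the end. -/
lemma reaches_signed (k : ℕ) {u : PressureList N}
    (hu : (∀ a, -(k : ℤ) ≤ u a) ∨ ∀ a, u a ≤ k) :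
    Reaches IsMaximal {u | (∀ a, 0 ≤ u a) ∨ ∀ a, u a ≤ 0} k u := by
  induction k generalizing u with
  | zero => exact .done (by simpa using hu)
  | succ k ih =>
    obtain ⟨p, hp⟩ := exists_isMaximal u
    refine .step p hp (ih ?_)
    have habs := fun a => abs_le.1 (hp.abs_le a)
    rcases units_coe_cases p.2 with ⟨-, h⟩ | ⟨-, h⟩
    · have hlow : ∀ a, -((k : ℤ) + 1) ≤ u a := by
        rcases hu with hu | hu
        · intro a; have := hu a; push_cast at this; linarith
        · intro a; have := habs a; have := hu p.1; rw [h] at *; push_cast at this; linarith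
      left
      intro a
      by_cases hap : a = p.1
      · rw [hap, express_self]; omega
      · rw [express_of_ne hap, h]; linarith [hlow a]
    · have hup : ∀ a, u a ≤ (k : ℤ) + 1 := by
        rcases hu with hu | hu
        · intro a; have := habs a; have := hu p.1; rw [h] at *; push_cast at this; linarith
        · intro a; have := hu a; push_cast at this; linarith
      right
      intro a
      by_cases hap : a = p.1
      · rw [hap, express_self]; omega
      · rw [express_of_ne hap, h]; linarith [hup a]

/-- From every list, `3 N` maximal moves lead to a ladder or to a negative consensus. -/
lemma reaches_ladder_union (hN : 2 ≤ N) (u : PressureList N) :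
    Reaches IsMaximal (ladder N ∪ negativeConsensus N) (N + (N + N)) u := by
  refine (reaches_bounded u).trans fun w hw => (reaches_signed N ?_).trans fun x hx => ?_
  · exact .inl fun a => (abs_le.1 (hw a)).1
  · by_cases hx0 : ∀ a, 0 ≤ x a
    · simpa using (reaches_ladder hx0).trans (B' := ladder N ∪ negativeConsensus N) (m := 0)
        fun y hy => .done (.inl hy)
    · have hx1 := hx.resolve_left hx0
      obtain ⟨p, hp⟩ := exists_isMaximal x
      have hp1 : p.2 = -1 := by
        rcases units_coe_cases p.2 with ⟨-, h⟩ | ⟨h, -⟩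
        · exfalso
          push Not at hx0
          obtain ⟨a, ha⟩ := hx0
          have h1 := (abs_le.1 (hp.abs_le a)).1
          rw [h] at h1
          linarith [hx1 p.1]
        · exact h
      refine Reaches.mono (n := 1) (.step p hp (.done (.inr ?_))) (fun _ _ h => h) (by omega)
      exact express_neg_mem_negativeConsensus hN hx1 hp1

/-- If the actors `0, 1, …` express a negative opinion in turn, the result is a negative
consensus. -/
lemma reaches_negativeConsensus_aux (hN : 2 ≤ N) (n : ℕ) {s : ℕ} (hs : s + n = N)
    {u : PressureList N} (hb : ∀ a, |u a| ≤ N + s) (hu : ∀ a : Fin N, a.val < s → u a ≤ 0) :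
    Reaches (fun u _ => ∀ a, |u a| ≤ 2 * N) (negativeConsensus N) (n + 1) u := by
  induction n generalizing s u with
  | zero =>
    refine .step (0, -1) (fun a => (hb a).trans (by omega)) (.done ?_)
    exact express_neg_mem_negativeConsensus hN (fun a => hu a (by omega)) rfl
  | succ n ih =>
    set a : Fin N := ⟨s, by omega⟩
    refine .step (a, -1) (fun a => (hb a).trans (by omega))
      (ih (s := s + 1) (by omega) (fun b => ?_) fun b hbs => ?_)
    · by_cases hba : b = a
      · rw [hba, express_self (a, -1)]; simp; positivity
      · rw [express_of_ne (p := (a, -1)) hba]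
        refine (abs_add_le _ _).trans ?_
        have := hb b
        simp
        omega
    · by_cases hba : b = a
      · rw [hba, express_self (a, -1)]
      · rw [express_of_ne (p := (a, -1)) hba]
        have h1 : b.val ≠ s := fun h => hba (Fin.ext h)
        have := hu b (by omega)
        simp
        omega

lemma exists_reaches_negativeConsensus (hN : 2 ≤ N) {β : ℝ} (hβ : 0 ≤ β) :
    ∃ c : ℝ, 0 < c ∧ c ≤ 1 ∧ ∀ u : PressureList N, Reaches (fun u p => c ≤ jumpProb β u p)
      (negativeConsensus N) (N + (N + 1)) u := by
  have hN0 : (0 : ℝ) < N := by exact_mod_cast NeZero.pos N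
  have hN1 : (1 : ℝ) ≤ N := by exact_mod_cast NeZero.one_le
  set c := Real.exp (-(β * (4 * N))) / (2 * N : ℝ)
  have hE : Real.exp (-(β * (4 * N))) ≤ 1 := Real.exp_le_one_iff.2 (by
    have : 0 ≤ β * (4 * N) := by positivity
    linarith)
  have hc : c ≤ 1 / (2 * N : ℝ) := div_le_div_of_nonneg_right hE (by positivity)
  refine ⟨c, by positivity, hc.trans ?_, fun u => ?_⟩
  · rw [div_le_one (by positivity)]; linarith
  · refine ((reaches_bounded u).mono (fun u p hp => hc.trans (hp.le_jumpProb hβ)) le_rfl).trans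
      fun w hw => ?_
    refine (reaches_negativeConsensus_aux hN N (s := 0) (by omega) (by simpa using hw)
      (by simp)).mono (fun x p hx => ?_) le_rfl
    have hx' : ∀ q : Mark N, |(q.2 : ℤ) * x q.1| ≤ 2 * N := fun q => by
      rw [abs_mul]
      rcases units_coe_cases q.2 with ⟨-, h⟩ | ⟨-, h⟩ <;> rw [h] <;> simpa using hx q.1
    have h1 := totalRate_le (β := β) hβ (u := x) (k := 2 * N) fun q => (abs_le.1 (hx' q)).2
    have h2 : Real.exp (-(β * (2 * N))) ≤ rate β x p := by
      rw [rate_eq, ← mul_neg]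
      refine Real.exp_le_exp.2 (mul_le_mul_of_nonneg_left ?_ hβ)
      exact_mod_cast (abs_le.1 (hx' p)).1
    have h3 : Real.exp (-(β * (4 * N))) * Real.exp (β * (2 * N)) = Real.exp (-(β * (2 * N))) := by
      rw [← Real.exp_add]; ring_nf
    unfold jumpProb
    rw [div_le_div_iff₀ (by positivity) (totalRate_pos β x)]
    push_cast at h1
    calc _ ≤ Real.exp (-(β * (4 * N))) * (2 * N * Real.exp (β * (2 * N))) :=
          mul_le_mul_of_nonneg_left h1 (Real.exp_pos _).le
      _ = Real.exp (-(β * (2 * N))) * (2 * N) := by rw [← h3]; ring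
      _ ≤ _ := mul_le_mul_of_nonneg_right h2 (by positivity)

end SocialNetwork

namespace SocialNetwork

variable {N : ℕ}

/-! ### The equations of the mean and of the characteristic function -/

/-- The equations satisfied by the mean time, as a function of the initial list, that the process
takes to reach the negative consensus. -/
structure IsHittingMean (β : ℝ) (h : PressureList N → ℝ) : Prop where
  bddAbove : BddAbove (Set.range h)
  nonneg : ∀ u, 0 ≤ h u
  zero : ∀ u ∈ negativeConsensus N, h u = 0
  step : ∀ u ∉ negativeConsensus N, h u = 1 / totalRate β u + avg β h u

/-- The equations satisfied by the characteristic function at `θ`, as a function of the initial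
list, of the time that the process takes to reach the negative consensus. -/
structure IsHittingCharFun (β θ : ℝ) (f : PressureList N → ℂ) : Prop where
  norm_le : ∀ u, ‖f u‖ ≤ 1
  one : ∀ u ∈ negativeConsensus N, f u = 1
  step : ∀ u ∉ negativeConsensus N,
    f u = avg β f u + (θ * Complex.I / totalRate β u) * f u

/-- The list `0, 1, …, N - 1`. -/
def stdLadder (N : ℕ) : PressureList N := fun a => (a : ℕ)

lemma stdLadder_mem : stdLadder N ∈ ladder N :=
  ⟨fun a b h => Fin.ext (by simpa [stdLadder] using h), fun a => by simp [stdLadder]⟩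

lemma exists_perm_of_mem_ladder {u w : PressureList N} (hu : u ∈ ladder N) (hw : w ∈ ladder N) :
    ∃ σ : Equiv.Perm (Fin N), w = u ∘ σ := by
  have key : ∀ x ∈ ladder N, ∃ e : Equiv.Perm (Fin N), ∀ a, x a = ((e a : ℕ) : ℤ) := by
    intro x hx
    have hlt : ∀ a, (x a).toNat < N := fun a => by have := hx.2 a; omega
    have hinj : Function.Injective fun a => (⟨(x a).toNat, hlt a⟩ : Fin N) := by
      intro a b h
      have h' : (x a).toNat = (x b).toNat := by simpa using h
      apply hx.1
      have := hx.2 a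
      have := hx.2 b
      omega
    refine ⟨Equiv.ofBijective _ (Finite.injective_iff_bijective.1 hinj), fun a => ?_⟩
    have := hx.2 a
    simp
    omega
  obtain ⟨e, he⟩ := key u hu
  obtain ⟨e', he'⟩ := key w hw
  refine ⟨e'.trans e.symm, funext fun a => ?_⟩
  simp [he, he']

lemma totalRate_comp_perm (β : ℝ) (σ : Equiv.Perm (Fin N)) (u : PressureList N) :
    totalRate β (u ∘ σ) = totalRate β u := by
  unfold totalRate
  rw [← Equiv.sum_comp (σ.symm.prodCongr (Equiv.refl ℤˣ))]
  exact Finset.sum_congr rfl fun p _ => by simp [rate]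

lemma avg_comp_perm {E : Type*} [AddCommGroup E] [Module ℝ E] (β : ℝ) (g : PressureList N → E)
    (σ : Equiv.Perm (Fin N)) (u : PressureList N) :
    avg β g (u ∘ σ) = avg β (fun w => g (w ∘ σ)) u := by
  have hrate : ∀ p : Mark N, rate β (u ∘ σ) (σ.symm p.1, p.2) = rate β u p := fun p => by
    simp [rate]
  unfold avg
  rw [← Equiv.sum_comp (σ.symm.prodCongr (Equiv.refl ℤˣ))]
  refine Finset.sum_congr rfl fun p _ => ?_
  have hexp : express (σ.symm p.1, p.2) (u ∘ σ) = express p u ∘ σ := by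
    funext b
    simp [express, Equiv.eq_symm_apply]
  have h1 : (σ.symm.prodCongr (Equiv.refl ℤˣ)) p = (σ.symm p.1, p.2) := rfl
  rw [h1, hexp, jumpProb, jumpProb, hrate, totalRate_comp_perm]

lemma comp_perm_mem_negativeConsensus {σ : Equiv.Perm (Fin N)} {u : PressureList N}
    (hu : u ∈ negativeConsensus N) : u ∘ σ ∈ negativeConsensus N := by
  obtain ⟨⟨a, ha⟩, h0, h⟩ := hu
  refine ⟨⟨σ.symm a, by simpa using ha⟩, fun h1 => h0 ?_, fun b => h _⟩
  funext b
  simpa using congrFun h1 (σ.symm b)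

lemma comp_perm_mem_negativeConsensus_iff {σ : Equiv.Perm (Fin N)} {u : PressureList N} :
    u ∘ σ ∈ negativeConsensus N ↔ u ∈ negativeConsensus N := by
  refine ⟨fun h => ?_, comp_perm_mem_negativeConsensus⟩
  have := comp_perm_mem_negativeConsensus (σ := σ.symm) h
  rwa [Function.comp_assoc, Equiv.self_comp_symm, Function.comp_id] at this

lemma notMem_negativeConsensus {u : PressureList N} (hu : ∀ a, 0 ≤ u a) :
    u ∉ negativeConsensus N :=
  fun h => h.2.1 (funext fun a => le_antisymm (h.2.2 a) (hu a))

lemma norm_one_sub_mul_I_div (θ : ℝ) {Z : ℝ} (w : ℂ) :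
    ‖w‖ ≤ ‖w - (θ * Complex.I / Z) * w‖ := by
  have h1 : w - (θ * Complex.I / Z) * w = (1 - (θ * Complex.I / Z)) * w := by ring
  rw [h1, norm_mul]
  refine le_mul_of_one_le_left (norm_nonneg _) ?_
  refine le_trans ?_ (Complex.abs_re_le_norm _)
  have : (θ * Complex.I / Z : ℂ) = ((θ / Z : ℝ) : ℂ) * Complex.I := by push_cast; ring
  rw [this]
  simp

/-- The constant of the maximum principle for paths of `3 N` moves of probability `1 / (2 N)`; it
does not depend on `β`. -/
noncomputable def ladderConst (N : ℕ) : ℝ :=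
  ((N + (N + N) : ℕ) : ℝ) / (1 / (2 * N : ℝ)) ^ (N + (N + N))

lemma ladderConst_nonneg : 0 ≤ ladderConst N := by
  unfold ladderConst; positivity

lemma stdLadder_notMem_negativeConsensus : stdLadder N ∉ negativeConsensus N :=
  notMem_negativeConsensus fun a => (stdLadder_mem.2 a).1

/-- One minus the mean hitting time relative to the one from a ladder. Up to an error of the order
of `1 / h (stdLadder N)` this is the probability that the process started at `u` reaches the
negative consensus before the ladders. -/
noncomputable def escape (h : PressureList N → ℝ) (u : PressureList N) : ℝ :=
  1 - h u / h (stdLadder N)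

namespace IsHittingMean

variable {β : ℝ} {h : PressureList N → ℝ}

lemma escape_le_one (hh : IsHittingMean β h) (u : PressureList N) : escape h u ≤ 1 := by
  have := div_nonneg (hh.nonneg u) (hh.nonneg (stdLadder N))
  unfold escape; linarith

lemma escape_of_mem_negativeConsensus (hh : IsHittingMean β h) {u : PressureList N}
    (hu : u ∈ negativeConsensus N) : escape h u = 1 := by
  simp [escape, hh.zero u hu]

end IsHittingMean

/-- The nonnegative lists with distinct pressures. Positive opinions preserve this set, and one of
the pressures is at least `N - 1`, which makes negative opinions rare. -/
def distinctLists (N : ℕ) : Set (PressureList N) :=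
  {u | Function.Injective u ∧ ∀ a, 0 ≤ u a}

lemma express_one_mem_distinctLists {u : PressureList N} (hu : u ∈ distinctLists N) {p : Mark N}
    (hp : p.2 = 1) : express p u ∈ distinctLists N := by
  have hval : ∀ {b}, b ≠ p.1 → express p u b = u b + 1 := fun {b} hb => by
    rw [express_of_ne hb, hp]; simp
  refine ⟨fun a b hab => ?_, fun a => ?_⟩
  · by_cases ha : a = p.1 <;> by_cases hb : b = p.1
    · rw [ha, hb]
    · rw [ha, express_self, hval hb] at hab; have := hu.2 b; omega
    · rw [hb, express_self, hval ha] at hab; have := hu.2 a; omega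
    · rw [hval ha, hval hb] at hab; exact hu.1 (by omega)
  · by_cases ha : a = p.1
    · rw [ha, express_self]
    · rw [hval ha]; have := hu.2 a; omega

variable [NeZero N]

/-- The one-step equation determines a bounded function. -/
lemma eq_zero_of_norm_le_avg (hN : 2 ≤ N) {E : Type*} [NormedAddCommGroup E] {β : ℝ} (hβ : 0 ≤ β)
    {D : PressureList N → E} (hbdd : BddAbove (Set.range fun u => ‖D u‖))
    (h0 : ∀ u ∈ negativeConsensus N, D u = 0)
    (h : ∀ u ∉ negativeConsensus N, ‖D u‖ ≤ avg β (fun w => ‖D w‖) u) (u : PressureList N) :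
    D u = 0 := by
  obtain ⟨c, hc, hc1, hr⟩ := exists_reaches_negativeConsensus (N := N) hN hβ
  have := le_of_le_avg (β := β) (δ := 0) hc hc1 le_rfl hr hbdd (fun w hw => by simp [h0 w hw])
    (fun w hw => by simpa using h w hw) u
  simpa using this

/-- The maximum principle for sets which contain the ladders and the negative consensus, with a
constant that is uniform in `β`. -/
lemma le_ladderConst_mul (hN : 2 ≤ N) {β δ : ℝ} (hβ : 0 ≤ β) {B : Set (PressureList N)}
    {g : PressureList N → ℝ} (hδ : 0 ≤ δ) (hsub : ladder N ∪ negativeConsensus N ⊆ B)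
    (hbdd : BddAbove (Set.range g)) (hB : ∀ u ∈ B, g u ≤ 0)
    (hstep : ∀ u ∉ B, g u ≤ δ + avg β g u) (u : PressureList N) : g u ≤ ladderConst N * δ := by
  have hN0 : (1 : ℝ) ≤ N := by exact_mod_cast NeZero.one_le
  have := le_of_le_avg (β := β) (c := 1 / (2 * N : ℝ)) (K := N + (N + N)) (by positivity)
    (by rw [div_le_one (by positivity)]; linarith) hδ
    (fun u => ((reaches_ladder_union hN u).mono (fun _ _ hp => hp.le_jumpProb hβ) le_rfl).trans
      (m := 0) fun w hw => .done (hsub hw)) hbdd hB hstep u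
  unfold ladderConst
  rwa [div_mul_eq_mul_div]

namespace IsHittingMean

variable {β : ℝ} {h : PressureList N → ℝ}

lemma eq_of_mem_ladder (hh : IsHittingMean β h) (hN : 2 ≤ N) (hβ : 0 ≤ β) {u : PressureList N}
    (hu : u ∈ ladder N) : h u = h (stdLadder N) := by
  obtain ⟨σ, rfl⟩ := exists_perm_of_mem_ladder stdLadder_mem hu
  obtain ⟨C, hC⟩ := hh.bddAbove
  have hC' : ∀ w, h w ≤ C := fun w => hC ⟨w, rfl⟩
  refine sub_eq_zero.1 (eq_zero_of_norm_le_avg (β := β) hN hβ (D := fun w => h (w ∘ σ) - h w)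
    ⟨C, ?_⟩ ?_ ?_ _)
  · rintro _ ⟨w, rfl⟩
    change |h (w ∘ σ) - h w| ≤ C
    rw [abs_le]
    constructor <;> linarith [hC' w, hC' (w ∘ σ), hh.nonneg w, hh.nonneg (w ∘ σ)]
  · intro w hw
    rw [hh.zero w hw, hh.zero _ (comp_perm_mem_negativeConsensus hw), sub_zero]
  · intro w hw
    have h1 := hh.step w hw
    have h2 := hh.step (w ∘ σ) (comp_perm_mem_negativeConsensus_iff.not.2 hw)
    rw [totalRate_comp_perm, avg_comp_perm] at h2
    have h3 : h (w ∘ σ) - h w = avg β (fun x => h (x ∘ σ) - h x) w := by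
      rw [avg_sub, h1, h2]; ring
    rw [h3]
    exact norm_avg_le β _ w

lemma pos (hh : IsHittingMean β h) {u : PressureList N} (hu : u ∉ negativeConsensus N) :
    0 < h u := by
  rw [hh.step u hu]
  have h1 : 0 ≤ avg β h u :=
    Finset.sum_nonneg fun p _ => smul_nonneg (jumpProb_nonneg β u p) (hh.nonneg _)
  have h2 := totalRate_pos β u
  positivity

lemma stdLadder_pos (hh : IsHittingMean β h) : 0 < h (stdLadder N) := hh.pos stdLadder_notMem_negativeConsensus

lemma escape_of_mem_ladder (hh : IsHittingMean β h) (hN : 2 ≤ N) (hβ : 0 ≤ β)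
    {u : PressureList N} (hu : u ∈ ladder N) : escape h u = 0 := by
  rw [escape, hh.eq_of_mem_ladder hN hβ hu, div_self hh.stdLadder_pos.ne', sub_self]

lemma avg_escape (h : PressureList N → ℝ) (u : PressureList N) :
    avg β (escape h) u = 1 - avg β h u / h (stdLadder N) := by
  have : escape h = fun w => (fun _ => (1 : ℝ)) w - (h (stdLadder N))⁻¹ * h w := by
    funext w; simp [escape, div_eq_inv_mul]
  rw [this, avg_sub, avg_const, avg_const_mul, div_eq_inv_mul]

lemma escape_step (hh : IsHittingMean β h) {u : PressureList N}
    (hu : u ∉ negativeConsensus N) :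
    escape h u = avg β (escape h) u - 1 / (totalRate β u * h (stdLadder N)) := by
  have := hh.stdLadder_pos
  have := totalRate_pos β u
  rw [avg_escape, escape, hh.step u hu]
  field_simp
  ring

lemma escape_le_avg (hh : IsHittingMean β h) {u : PressureList N}
    (hu : u ∉ negativeConsensus N) : escape h u ≤ avg β (escape h) u := by
  rw [hh.escape_step hu]
  have := hh.stdLadder_pos
  have := totalRate_pos β u
  have : 0 ≤ 1 / (totalRate β u * h (stdLadder N)) := by positivity
  linarith

lemma one_div_totalRate_mul_le (hh : IsHittingMean β h) (hβ : 0 ≤ β) (u : PressureList N) :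
    1 / (totalRate β u * h (stdLadder N)) ≤ 1 / h (stdLadder N) :=
  one_div_le_one_div_of_le hh.stdLadder_pos
    (le_mul_of_one_le_left hh.stdLadder_pos.le (one_le_totalRate hβ u))

lemma neg_le_escape (hh : IsHittingMean β h) (hN : 2 ≤ N) (hβ : 0 ≤ β) (u : PressureList N) :
    -(ladderConst N / h (stdLadder N)) ≤ escape h u := by
  obtain ⟨C, hC⟩ := hh.bddAbove
  have hm := hh.stdLadder_pos
  have := le_ladderConst_mul hN hβ (B := ladder N ∪ negativeConsensus N)
    (g := fun w => -1 * escape h w) (δ := 1 / h (stdLadder N)) (by positivity) subset_rfl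
    ⟨C / h (stdLadder N), ?_⟩ ?_ ?_ u
  · rw [div_eq_mul_one_div]; linarith
  · rintro _ ⟨w, rfl⟩
    have : h w / h (stdLadder N) ≤ C / h (stdLadder N) :=
      div_le_div_of_nonneg_right (hC ⟨w, rfl⟩) hm.le
    simp only [escape]; linarith
  · rintro w (hw | hw)
    · rw [hh.escape_of_mem_ladder hN hβ hw]; simp
    · rw [hh.escape_of_mem_negativeConsensus hw]; simp
  · intro w hw
    rw [avg_const_mul, hh.escape_step fun h => hw (.inr h)]
    linarith [hh.one_div_totalRate_mul_le hβ w]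

/-- From a nonnegative list, only a move that is not maximal can keep the process from building a
ladder. -/
lemma escape_le_of_mem_ladderStage (hh : IsHittingMean β h) (hN : 2 ≤ N) (hβ : 0 ≤ β) (n : ℕ)
    {s : ℕ} (hs : s + n = N) {u : PressureList N} (hu : u ∈ ladderStage N s) (hu0 : u ≠ 0) :
    escape h u ≤ n * (2 * N * Real.exp (-β)) := by
  induction n generalizing s u with
  | zero =>
    obtain rfl : s = N := by omega
    simp [hh.escape_of_mem_ladder hN hβ (mem_ladder_of_mem_ladderStage hu)]
  | succ n ih =>
    have hnn := nonneg_of_mem_ladderStage hu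
    refine (hh.escape_le_avg (notMem_negativeConsensus hnn)).trans ?_
    set X := (n : ℝ) * (2 * N * Real.exp (-β))
    have hX : 0 ≤ X := by positivity
    calc avg β (escape h) u ≤ ∑ p, (jumpProb β u p * X + Real.exp (-β)) := by
          refine Finset.sum_le_sum fun p _ => ?_
          rw [smul_eq_mul]
          by_cases hp : IsMaximal u p
          · have hp1 := hp.eq_one hnn hu0
            have ha : ∀ b, u b ≤ u p.1 := fun b => by
              have := hp (b, 1)
              rw [hp1] at this
              simpa using this
            have hpe : p = (p.1, 1) := Prod.ext rfl hp1
            have h1 : escape h (express p u) ≤ X := by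
              refine ih (s := s + 1) (by omega) ?_ ?_
              · rw [hpe]; exact express_mem_ladderStage hu (by omega) ha
              · rw [hpe]; exact express_one_ne_zero hN hnn _
            have := mul_le_mul_of_nonneg_left h1 (jumpProb_nonneg β u p)
            linarith [Real.exp_pos (-β)]
          · obtain ⟨r, hr⟩ : ∃ r : Mark N, (p.2 : ℤ) * u p.1 < (r.2 : ℤ) * u r.1 := by
              simpa [IsMaximal] using hp
            have h1 := jumpProb_le hβ (k := 1) (Int.add_one_le_iff.2 hr)
            have h2 := mul_le_mul_of_nonneg_left (hh.escape_le_one (express p u))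
              (jumpProb_nonneg β u p)
            have h3 := mul_nonneg (jumpProb_nonneg β u p) hX
            simp only [Int.cast_one, mul_one] at h1 h2
            linarith
      _ = X + 2 * N * Real.exp (-β) := by
          rw [Finset.sum_add_distrib, ← Finset.sum_mul, sum_jumpProb, Finset.sum_const,
            nsmul_eq_mul, Finset.card_univ, card_mark, one_mul]
      _ = _ := by simp only [X]; push_cast; ring

lemma escape_le_of_nonneg (hh : IsHittingMean β h) (hN : 2 ≤ N) (hβ : 0 ≤ β)
    {u : PressureList N} (hu : ∀ a, 0 ≤ u a) (hu0 : u ≠ 0) :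
    escape h u ≤ N * (2 * N * Real.exp (-β)) :=
  hh.escape_le_of_mem_ladderStage hN hβ N (s := 0) (by omega) (mem_ladderStage_zero hu) hu0

end IsHittingMean

lemma exists_le_of_mem_distinctLists {u : PressureList N} (hu : u ∈ distinctLists N) :
    ∃ a, (N : ℤ) - 1 ≤ u a := by
  by_contra! hlt
  have hN := NeZero.pos N
  have hinj : Function.Injective fun a => (⟨(u a).toNat, by
      have := hlt a; have := hu.2 a; omega⟩ : Fin (N - 1)) := by
    intro a b hab
    have h' : (u a).toNat = (u b).toNat := by simpa using hab
    apply hu.1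
    have := hu.2 a
    have := hu.2 b
    omega
  have := Fintype.card_le_of_injective _ hinj
  simp at this
  omega

namespace IsHittingMean

variable {β : ℝ} {h : PressureList N → ℝ}

open Classical in
/-- A negative opinion in a list with distinct pressures has probability of the order of
`exp (-β (N - 1))`, and then either it comes from an actor with positive pressure, which costs
another factor `exp (-β)`, or the list stays nonnegative. -/
lemma avg_escape_le (hh : IsHittingMean β h) (hN : 3 ≤ N) (hβ : 0 ≤ β) {u : PressureList N}
    (hu : u ∈ distinctLists N) :
    avg β (escape h) u ≤ 4 * N ^ 3 * Real.exp (-(β * N)) +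
      avg β (fun w => if w ∈ distinctLists N then escape h w else 0) u := by
  have hN1 : (1 : ℝ) ≤ N := by exact_mod_cast NeZero.one_le
  obtain ⟨a₀, ha₀⟩ := exists_le_of_mem_distinctLists hu
  have hE := Real.exp_pos (-(β * N))
  calc avg β (escape h) u
      ≤ ∑ p, (2 * N ^ 2 * Real.exp (-(β * N)) + jumpProb β u p •
        (if express p u ∈ distinctLists N then escape h (express p u) else 0)) := by
        refine Finset.sum_le_sum fun p _ => ?_
        have hP := jumpProb_nonneg β u p
        by_cases hp : express p u ∈ distinctLists N
        · rw [if_pos hp]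
          have : 0 ≤ 2 * (N : ℝ) ^ 2 * Real.exp (-(β * N)) := by positivity
          linarith
        rw [if_neg hp, smul_zero, add_zero, smul_eq_mul]
        have hp1 : p.2 = -1 := by
          rcases units_coe_cases p.2 with ⟨h1, -⟩ | ⟨h1, -⟩
          · exact absurd (express_one_mem_distinctLists hu h1) hp
          · exact h1
        rcases (hu.2 p.1).eq_or_lt with h0 | h0
        · have hw : ∀ b, b ≠ p.1 → 1 ≤ u b := fun b hb => by
            have := hu.2 b
            have : u b ≠ u p.1 := fun h => hb (hu.1 h)
            omega
          have ha₀p : a₀ ≠ p.1 := fun h => by rw [h] at ha₀; omega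
          have hnn : ∀ b, 0 ≤ express p u b := fun b => by
            by_cases hb : b = p.1
            · rw [hb, express_self]
            · rw [express_of_ne hb, hp1]; have := hw b hb; simp; omega
          have hne : express p u ≠ 0 := fun h => by
            have := congrFun h a₀
            rw [express_of_ne ha₀p, hp1] at this
            simp at this
            omega
          have h1 := hh.escape_le_of_nonneg (by omega) hβ hnn hne
          have h2 : jumpProb β u p ≤ Real.exp (-(β * ((N - 1 : ℤ) : ℝ))) :=
            jumpProb_le hβ (p := (a₀, 1)) (by rw [← h0]; simpa using ha₀)
          have h3 : Real.exp (-(β * ((N - 1 : ℤ) : ℝ))) * Real.exp (-β)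
              = Real.exp (-(β * N)) := by
            rw [← Real.exp_add]; push_cast; ring_nf
          calc _ ≤ jumpProb β u p * (N * (2 * N * Real.exp (-β))) :=
                mul_le_mul_of_nonneg_left h1 hP
            _ ≤ Real.exp (-(β * ((N - 1 : ℤ) : ℝ))) * (N * (2 * N * Real.exp (-β))) :=
                mul_le_mul_of_nonneg_right h2 (by positivity)
            _ = _ := by rw [← h3]; ring
        · have h2 : jumpProb β u p ≤ Real.exp (-(β * ((N : ℤ) : ℝ))) :=
            jumpProb_le hβ (p := (a₀, 1)) (by rw [hp1]; simp; omega)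
          have h1 := mul_le_mul_of_nonneg_left (hh.escape_le_one (express p u)) hP
          rw [Int.cast_natCast] at h2
          nlinarith [mul_le_mul_of_nonneg_right (show (1 : ℝ) ≤ 2 * N ^ 2 by nlinarith) hE.le]
    _ = _ := by
        rw [Finset.sum_add_distrib, Finset.sum_const, nsmul_eq_mul, Finset.card_univ, card_mark]
        unfold avg
        ring

/-- The mean time to reach the negative consensus from a ladder grows at least like `exp β`. -/
lemma one_div_le (hh : IsHittingMean β h) (hN : 3 ≤ N) (hβ : 0 ≤ β) :
    1 / h (stdLadder N) ≤ 8 * N ^ 4 * (1 + ladderConst N) * Real.exp (-β) := by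
  classical
  set δ := 4 * (N : ℝ) ^ 3 * Real.exp (-(β * N))
  have hδ : 0 ≤ δ := by positivity
  set g : PressureList N → ℝ := fun w => if w ∈ distinctLists N then escape h w else 0
  have hg : ∀ w, g w ≤ ladderConst N * δ := by
    refine le_ladderConst_mul (by omega) hβ
      (B := ladder N ∪ negativeConsensus N ∪ (distinctLists N)ᶜ) hδ
      Set.subset_union_left ⟨1, ?_⟩ ?_ ?_
    · rintro _ ⟨w, rfl⟩
      simp only [g]
      split_ifs
      · exact hh.escape_le_one w
      · exact zero_le_one
    · intro w hw
      simp only [g]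
      split_ifs with hD
      · rcases hw with (hw | hw) | hw
        · exact (hh.escape_of_mem_ladder (by omega) hβ hw).le
        · exact absurd hw (notMem_negativeConsensus hD.2)
        · exact absurd hD hw
      · exact le_rfl
    · intro w hw
      have hD : w ∈ distinctLists N := by by_contra h'; exact hw (.inr h')
      have h1 : g w = escape h w := if_pos hD
      rw [h1]
      exact (hh.escape_le_avg fun h' => hw (.inl (.inr h'))).trans (hh.avg_escape_le hN hβ hD)
  have hL : stdLadder N ∈ distinctLists N := ⟨stdLadder_mem.1, fun a => (stdLadder_mem.2 a).1⟩
  have h1 := hh.escape_step stdLadder_notMem_negativeConsensus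
  rw [hh.escape_of_mem_ladder (by omega) hβ stdLadder_mem] at h1
  have h2 := hh.avg_escape_le hN hβ hL
  have h3 : avg β g (stdLadder N) ≤ ladderConst N * δ :=
    (avg_mono hg).trans (avg_const β _ _).le
  have hZ : totalRate β (stdLadder N) ≤ 2 * N * Real.exp (β * ((N - 1 : ℤ) : ℝ)) := by
    refine totalRate_le hβ fun p => ?_
    have := stdLadder_mem.2 p.1
    rcases units_coe_cases p.2 with ⟨-, h⟩ | ⟨-, h⟩ <;> rw [h] <;> omega
  have hZ0 := totalRate_pos β (stdLadder N)
  have hm := hh.stdLadder_pos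
  have h4 : 1 / (totalRate β (stdLadder N) * h (stdLadder N)) ≤ (1 + ladderConst N) * δ := by
    linarith
  have h5 : 1 / h (stdLadder N) ≤ totalRate β (stdLadder N) * ((1 + ladderConst N) * δ) := by
    have : 1 / h (stdLadder N) = totalRate β (stdLadder N) *
      (1 / (totalRate β (stdLadder N) * h (stdLadder N))) := by field_simp
    rw [this]
    exact mul_le_mul_of_nonneg_left h4 hZ0.le
  have hκ := ladderConst_nonneg (N := N)
  have h6 : Real.exp (β * ((N - 1 : ℤ) : ℝ)) * Real.exp (-(β * N)) = Real.exp (-β) := by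
    rw [← Real.exp_add]; push_cast; ring_nf
  calc _ ≤ _ := h5
    _ ≤ 2 * N * Real.exp (β * ((N - 1 : ℤ) : ℝ)) * ((1 + ladderConst N) * δ) :=
        mul_le_mul_of_nonneg_right hZ (by positivity)
    _ = _ := by simp only [δ]; rw [← h6]; ring

end IsHittingMean

end SocialNetwork

namespace SocialNetwork

variable {N : ℕ} [NeZero N]

/-! ### The characteristic function from a ladder -/

namespace IsHittingCharFun

variable {β θ : ℝ} {h : PressureList N → ℝ} {f : PressureList N → ℂ}

lemma eq_of_mem_ladder (hf : IsHittingCharFun β θ f) (hN : 2 ≤ N) (hβ : 0 ≤ β)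
    {u : PressureList N} (hu : u ∈ ladder N) : f u = f (stdLadder N) := by
  obtain ⟨σ, rfl⟩ := exists_perm_of_mem_ladder stdLadder_mem hu
  refine sub_eq_zero.1 (eq_zero_of_norm_le_avg (β := β) hN hβ (D := fun w => f (w ∘ σ) - f w)
    ⟨2, ?_⟩ ?_ ?_ _)
  · rintro _ ⟨w, rfl⟩
    have := norm_sub_le (f (w ∘ σ)) (f w)
    have := hf.norm_le w
    have := hf.norm_le (w ∘ σ)
    change ‖f (w ∘ σ) - f w‖ ≤ 2
    linarith
  · intro w hw
    rw [hf.one w hw, hf.one _ (comp_perm_mem_negativeConsensus hw), sub_self]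
  · intro w hw
    have h1 := hf.step w hw
    have h2 := hf.step (w ∘ σ) (comp_perm_mem_negativeConsensus_iff.not.2 hw)
    rw [totalRate_comp_perm, avg_comp_perm] at h2
    have h3 : (f (w ∘ σ) - f w) - (θ * Complex.I / totalRate β w) * (f (w ∘ σ) - f w)
        = avg β (fun x => f (x ∘ σ) - f x) w := by
      rw [avg_sub]; linear_combination h2 - h1
    refine (norm_one_sub_mul_I_div θ (Z := totalRate β w) _).trans ?_
    rw [h3]
    exact norm_avg_le β _ w

lemma norm_I_div_mul_le (u : PressureList N) (w : ℂ) :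
    ‖(θ * Complex.I / totalRate β u) * w‖ ≤ |θ| / totalRate β u * ‖w‖ := by
  rw [norm_mul, norm_div, norm_mul, Complex.norm_I, mul_one, Complex.norm_real, Complex.norm_real,
    Real.norm_eq_abs, Real.norm_of_nonneg (totalRate_pos β u).le]

lemma abs_div_totalRate_le (hβ : 0 ≤ β) (u : PressureList N) : |θ| / totalRate β u ≤ |θ| :=
  div_le_self (abs_nonneg θ) (one_le_totalRate hβ u)

/-- The characteristic function from `u` differs from the one from a ladder by the effect of the
short time taken to reach a ladder, unless the negative consensus is reached first. -/
lemma norm_sub_le (hf : IsHittingCharFun β θ f) (hh : IsHittingMean β h) (hN : 2 ≤ N)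
    (hβ : 0 ≤ β) (u : PressureList N) :
    ‖f u - f (stdLadder N)‖ ≤
      2 * escape h u + ladderConst N * (|θ| + 2 / h (stdLadder N)) := by
  have hm := hh.stdLadder_pos
  have hd2 : ∀ w, ‖f w - f (stdLadder N)‖ ≤ 2 := fun w => by
    have := _root_.norm_sub_le (f w) (f (stdLadder N))
    have := hf.norm_le w
    have := hf.norm_le (stdLadder N)
    linarith
  have := le_ladderConst_mul hN hβ (B := ladder N ∪ negativeConsensus N)
    (g := fun w => ‖f w - f (stdLadder N)‖ - 2 * escape h w)
    (δ := |θ| + 2 / h (stdLadder N)) (by positivity) subset_rfl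
    ⟨2 + 2 * (ladderConst N / h (stdLadder N)), ?_⟩ ?_ ?_ u
  · linarith
  · rintro _ ⟨w, rfl⟩
    have := hh.neg_le_escape hN hβ w
    have := hd2 w
    simp only
    linarith
  · rintro w (hw | hw)
    · rw [hf.eq_of_mem_ladder hN hβ hw, hh.escape_of_mem_ladder hN hβ hw]; simp
    · rw [hh.escape_of_mem_negativeConsensus hw]; linarith [hd2 w]
  · intro w hw
    have hw' : w ∉ negativeConsensus N := fun h => hw (.inr h)
    have h1 : f w - f (stdLadder N) = avg β (fun x => f x - f (stdLadder N)) w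
        + (θ * Complex.I / totalRate β w) * f w := by
      rw [avg_sub, avg_const]; linear_combination hf.step w hw'
    have h2 : ‖(θ * Complex.I / totalRate β w) * f w‖ ≤ |θ| :=
      (norm_I_div_mul_le w _).trans <| (mul_le_of_le_one_right (by
        have := totalRate_pos β w; positivity) (hf.norm_le w)).trans (abs_div_totalRate_le hβ w)
    have h3 : ‖f w - f (stdLadder N)‖ ≤ avg β (fun x => ‖f x - f (stdLadder N)‖) w + |θ| := by
      refine (congrArg norm h1).le.trans ((norm_add_le _ _).trans ?_)
      exact add_le_add (norm_avg_le β _ w) h2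
    have h4 := hh.escape_step hw'
    have h5 := hh.one_div_totalRate_mul_le hβ w
    have h6 : 2 / h (stdLadder N) = 2 * (1 / h (stdLadder N)) := by ring
    rw [avg_sub, avg_const_mul]
    linarith

/-- The value `φ` of the characteristic function at the ladders nearly solves
`1 - φ + i θ m φ = 0`, where `m` is the mean hitting time from a ladder: the process spends most
of its time at lists from which the characteristic function is close to `φ`. -/
lemma norm_one_sub_add_le (hf : IsHittingCharFun β θ f) (hh : IsHittingMean β h) (hN : 2 ≤ N)
    (hβ : 0 ≤ β) {ε : ℝ} (hε : 0 < ε) :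
    ‖1 - f (stdLadder N) + θ * Complex.I * f (stdLadder N) * h (stdLadder N)‖ ≤
      |θ| * h (stdLadder N) * (2 * ε + ladderConst N * (|θ| + 2 / h (stdLadder N))) +
        2 * ladderConst N * |θ| / ε := by
  set φ := f (stdLadder N)
  set m := h (stdLadder N)
  set κ := ladderConst N
  have hκ : 0 ≤ κ := ladderConst_nonneg
  have hm : 0 < m := hh.stdLadder_pos
  obtain ⟨C, hC⟩ := hh.bddAbove
  have hC' : ∀ w, h w ≤ C := fun w => hC ⟨w, rfl⟩
  set e : PressureList N → ℂ := fun w => (1 - f w) + θ * Complex.I * φ * h w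
  set A := |θ| * (2 * ε + κ * (|θ| + 2 / m))
  have hA : 0 ≤ A := by positivity
  have hφ : ‖φ‖ ≤ 1 := hf.norm_le _
  have hcoe : ∀ w, ((avg β h w : ℝ) : ℂ) = avg β (fun x => (h x : ℂ)) w := fun w => by
    simp [avg]
  have hestep : ∀ w ∉ negativeConsensus N,
      e w = avg β e w + -((θ * Complex.I / totalRate β w) * (f w - φ)) := by
    intro w hw
    have h1 := hf.step w hw
    have h2 : (h w : ℂ) = 1 / totalRate β w + avg β (fun x => (h x : ℂ)) w := by
      rw [← hcoe]; exact_mod_cast congrArg ((↑) : ℝ → ℂ) (hh.step w hw)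
    have h3 : avg β e w = (1 - avg β f w) + θ * Complex.I * φ * avg β (fun x => (h x : ℂ)) w := by
      simp only [e]
      rw [avg_add, avg_sub, avg_const, avg_const_mul]
    rw [h3]
    simp only [e]
    rw [h2]
    linear_combination -h1
  set g : PressureList N → ℝ := fun w => ‖e w‖ - A * h w
  have hg0 : ∀ w ∈ negativeConsensus N, g w = 0 := fun w hw => by
    simp [g, e, hh.zero w hw, hf.one w hw]
  have hgstep : ∀ w ∉ negativeConsensus N,
      g w ≤ avg β g w + |θ| / totalRate β w * (2 * (escape h w - ε)) := by
    intro w hw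
    have h1 : ‖e w‖ ≤ avg β (fun x => ‖e x‖) w + |θ| / totalRate β w * ‖f w - φ‖ := by
      refine (congrArg norm (hestep w hw)).le.trans ((norm_add_le _ _).trans ?_)
      rw [norm_neg]
      exact add_le_add (norm_avg_le β _ w) (norm_I_div_mul_le w _)
    have h2 := mul_le_mul_of_nonneg_left (hf.norm_sub_le hh hN hβ w)
      (div_nonneg (abs_nonneg θ) (totalRate_pos β w).le)
    have h3 : A * h w = |θ| / totalRate β w * (2 * ε + κ * (|θ| + 2 / m)) + A * avg β h w := by
      rw [hh.step w hw]; simp only [A]; ring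
    simp only [g]
    rw [avg_sub, avg_const_mul, h3]
    linarith
  have hgbdd : ∀ w, g w ≤ 2 + |θ| * C := by
    intro w
    have h1 : ‖e w‖ ≤ 2 + |θ| * h w := by
      refine (norm_add_le _ _).trans (add_le_add ?_ ?_)
      · have := _root_.norm_sub_le 1 (f w)
        have := hf.norm_le w
        rw [norm_one] at *
        linarith
      · rw [norm_mul, norm_mul, norm_mul, Complex.norm_I, mul_one, Complex.norm_real,
          Complex.norm_real, Real.norm_eq_abs, Real.norm_of_nonneg (hh.nonneg w)]
        refine mul_le_mul_of_nonneg_right ?_ (hh.nonneg w)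
        exact mul_le_of_le_one_right (abs_nonneg θ) hφ
    have h2 := mul_nonneg hA (hh.nonneg w)
    have h3 := mul_le_mul_of_nonneg_left (hC' w) (abs_nonneg θ)
    simp only [g]
    linarith
  have hgb : BddAbove (Set.range g) := ⟨2 + |θ| * C, by rintro _ ⟨w, rfl⟩; exact hgbdd w⟩
  set M := max (⨆ w, g w) 0
  have hM0 : 0 ≤ M := le_max_right _ _
  have hgM : ∀ w, g w ≤ M := fun w => (le_ciSup hgb w).trans (le_max_left _ _)
  -- Up to the arrival at a ladder `g` grows by at most a multiple of `|θ|`.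
  have hreturn : ∀ w, g w ≤ M * (1 - escape h w) + κ * (2 * |θ|) := by
    intro w
    have := le_ladderConst_mul hN hβ (B := ladder N ∪ negativeConsensus N)
      (g := fun x => g x - (M - M * escape h x)) (δ := 2 * |θ|) (by positivity) subset_rfl
      ⟨2 + |θ| * C, ?_⟩ ?_ ?_ w
    · linarith
    · rintro _ ⟨x, rfl⟩
      have := hgbdd x
      have := mul_le_mul_of_nonneg_left (hh.escape_le_one x) hM0
      simp only
      linarith
    · rintro x (hx | hx)
      · rw [hh.escape_of_mem_ladder hN hβ hx]; linarith [hgM x]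
      · rw [hh.escape_of_mem_negativeConsensus hx, hg0 x hx]; simp
    · intro x hx
      have hx' : x ∉ negativeConsensus N := fun h => hx (.inr h)
      have h1 := hgstep x hx'
      have h2 := mul_le_mul_of_nonneg_left (hh.escape_le_avg hx') hM0
      have h3 : |θ| / totalRate β x * (2 * (escape h x - ε)) ≤ |θ| * 2 := by
        have := hh.escape_le_one x
        exact (mul_le_mul_of_nonneg_left (by linarith)
          (div_nonneg (abs_nonneg θ) (totalRate_pos β x).le)).trans
          (mul_le_mul_of_nonneg_right (abs_div_totalRate_le hβ x) (by norm_num))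
      rw [avg_sub β g, avg_sub β (fun _ => M), avg_const, avg_const_mul]
      linarith
  -- Where `escape h ≤ ε` the function `g` is subharmonic, so that its supremum is the one over
  -- the other lists; there a fraction `ε` of the supremum is lost.
  set X := max (M * (1 - ε) + κ * (2 * |θ|)) 0
  have hgX : ∀ w, g w ≤ X := by
    intro w
    obtain ⟨c, hc, hc1, hr⟩ := exists_reaches_negativeConsensus (N := N) hN hβ
    have := le_of_le_avg (β := β) (δ := 0) (B := negativeConsensus N ∪ {x | ε < escape h x})
      (g := fun x => g x - X) hc hc1 le_rfl
      (fun u => (hr u).trans (m := 0) fun x hx => .done (.inl hx)) ⟨2 + |θ| * C, ?_⟩ ?_ ?_ w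
    · simpa using this
    · rintro _ ⟨x, rfl⟩
      have := hgbdd x
      have : 0 ≤ X := le_max_right _ _
      simp only
      linarith
    · rintro x (hx | hx)
      · rw [hg0 x hx]; have : 0 ≤ X := le_max_right _ _; linarith
      · have h1 := hreturn x
        have h2 : M * (1 - escape h x) ≤ M * (1 - ε) :=
          mul_le_mul_of_nonneg_left (by linarith [show ε < escape h x from hx]) hM0
        have h3 : M * (1 - ε) + κ * (2 * |θ|) ≤ X := le_max_left _ _
        linarith
    · intro x hx
      have h1 := hgstep x fun h => hx (.inl h)
      have h2 : escape h x ≤ ε := not_lt.1 fun h => hx (.inr h)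
      have h3 : |θ| / totalRate β x * (2 * (escape h x - ε)) ≤ 0 :=
        mul_nonpos_of_nonneg_of_nonpos (div_nonneg (abs_nonneg θ) (totalRate_pos β x).le)
          (by linarith)
      rw [avg_sub, avg_const]
      linarith
  have hMX : M ≤ X := max_le (ciSup_le hgX) (le_max_right _ _)
  have hM : M ≤ 2 * κ * |θ| / ε := by
    rw [le_div_iff₀ hε]
    rcases max_cases (M * (1 - ε) + κ * (2 * |θ|)) 0 with ⟨h1, _⟩ | ⟨h1, _⟩
    · have := hMX.trans h1.le
      linarith
    · have h2 : M = 0 := le_antisymm (hMX.trans h1.le) hM0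
      rw [h2, zero_mul]; positivity
  have h1 := (hgM (stdLadder N)).trans hM
  have h2 : |θ| * m * (2 * ε + κ * (|θ| + 2 / m)) = A * m := by simp only [A]; ring
  rw [h2]
  have h3 : g (stdLadder N) = ‖1 - φ + θ * Complex.I * φ * m‖ - A * m := rfl
  linarith

end IsHittingCharFun

/-! ### The limit of the characteristic function -/

open Topology in
/-- Asymptotic exponentiality on the level of characteristic functions. -/
lemma tendsto_hittingCharFun (hN : 3 ≤ N) {v : PressureList N} (hv : v ∈ positiveConsensus N)
    {h : ℝ → PressureList N → ℝ} (hh : ∀ β, 0 ≤ β → IsHittingMean β (h β)) (s : ℝ)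
    {f : ℝ → PressureList N → ℂ}
    (hf : ∀ β, 0 ≤ β → IsHittingCharFun β (s / h β v) (f β)) :
    Tendsto (fun β => f β v) atTop (𝓝 (1 / (1 - s * Complex.I))) := by
  have hN2 : 2 ≤ N := by omega
  set κ := ladderConst N
  have hκ : 0 ≤ κ := ladderConst_nonneg
  set L := stdLadder N
  have h0 : ∀ᶠ β : ℝ in atTop, 0 ≤ β := eventually_ge_atTop 0
  have hexp : Tendsto (fun β : ℝ => Real.exp (-β)) atTop (𝓝 0) :=
    Real.tendsto_exp_neg_atTop_nhds_zero
  have hinv : Tendsto (fun β => 1 / h β L) atTop (𝓝 0) := by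
    refine squeeze_zero' (h0.mono fun β hβ => ?_) (h0.mono fun β hβ => (hh β hβ).one_div_le hN hβ)
      (by simpa using hexp.const_mul (8 * (N : ℝ) ^ 4 * (1 + ladderConst N)))
    have := (hh β hβ).stdLadder_pos
    positivity
  have hesc : Tendsto (fun β => escape (h β) v) atTop (𝓝 0) := by
    refine tendsto_of_tendsto_of_tendsto_of_le_of_le' (g := fun β => -(κ * (1 / h β L)))
      (h := fun β => N * (2 * N * Real.exp (-β)))
      (by simpa using (hinv.const_mul κ).neg)
      (by simpa using (hexp.const_mul (2 * (N : ℝ))).const_mul (N : ℝ))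
      (h0.mono fun β hβ => ?_) (h0.mono fun β hβ => ?_)
    · have := (hh β hβ).neg_le_escape hN2 hβ v
      rwa [div_eq_mul_one_div] at this
    · exact (hh β hβ).escape_le_of_nonneg hN2 hβ hv.2.2 hv.2.1
  -- `a β = θ m` is the argument of the characteristic function in units of the mean time.
  set a : ℝ → ℝ := fun β => s / h β v * h β L
  have ha : Tendsto a atTop (𝓝 s) := by
    have h1 : Tendsto (fun β => s / (1 - escape (h β) v)) atTop (𝓝 (s / (1 - 0))) :=
      tendsto_const_nhds.div (tendsto_const_nhds.sub hesc) (by norm_num)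
    rw [sub_zero, div_one] at h1
    refine h1.congr' (h0.mono fun β _ => ?_)
    simp only [a, escape, L]
    rw [sub_sub_cancel, div_div_eq_mul_div, div_mul_eq_mul_div]
  have hθ : Tendsto (fun β => |s / h β v|) atTop (𝓝 0) := by
    have h1 : Tendsto (fun β => |a β| * (1 / h β L)) atTop (𝓝 (|s| * 0)) := ha.abs.mul hinv
    rw [mul_zero] at h1
    refine h1.congr' (h0.mono fun β hβ => ?_)
    have h2 := (hh β hβ).stdLadder_pos
    simp only [a, abs_mul, abs_of_pos h2, L]
    field_simp
  have hkap : Tendsto (fun β => κ * (|s / h β v| + 2 / h β L)) atTop (𝓝 0) := by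
    have := (hθ.add (hinv.const_mul 2)).const_mul κ
    simpa [div_eq_mul_inv] using this
  -- The threshold `ε = m ^ (-1/2)` balances the two error terms.
  set ε : ℝ → ℝ := fun β => √(1 / h β L)
  have hε : Tendsto ε atTop (𝓝 0) := by
    have := hinv.sqrt
    rwa [Real.sqrt_zero] at this
  have herr : Tendsto (fun β => (1 - f β L) + a β * Complex.I * f β L) atTop (𝓝 0) := by
    refine squeeze_zero_norm' (a := fun β => |a β| * (2 * ε β + κ * (|s / h β v| + 2 / h β L)) +
      2 * κ * (|a β| * ε β)) (h0.mono fun β hβ => ?_) ?_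
    · have hm : 0 < h β L := (hh β hβ).stdLadder_pos
      have hε0 : 0 < ε β := Real.sqrt_pos.2 (by positivity)
      have h1 := (hf β hβ).norm_one_sub_add_le (hh β hβ) hN2 hβ hε0
      have h2 : |a β| = |s / h β v| * h β L := by simp only [a, abs_mul, abs_of_pos hm, L]
      have h3 : 2 * κ * |s / h β v| / ε β = 2 * κ * (|a β| * ε β) := by
        have h4 : h β L * (ε β * ε β) = 1 := by
          rw [Real.mul_self_sqrt (by positivity), mul_one_div_cancel hm.ne']
        rw [h2, div_eq_iff hε0.ne']
        calc 2 * κ * |s / h β v| = 2 * κ * |s / h β v| * (h β L * (ε β * ε β)) := by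
              rw [h4, mul_one]
          _ = _ := by ring
      have h5 : (1 - f β L) + a β * Complex.I * f β L
          = 1 - f β L + (s / h β v : ℝ) * Complex.I * f β L * h β L := by
        simp only [a]; push_cast; ring
      rw [h5, ← h3, h2]
      exact h1
    · have h1 := (ha.abs.mul ((hε.const_mul 2).add hkap)).add
        ((ha.abs.mul hε).const_mul (2 * κ))
      simpa using h1
  have hden : Tendsto (fun β => (1 : ℂ) - a β * Complex.I) atTop (𝓝 (1 - s * Complex.I)) :=
    tendsto_const_nhds.sub
      (((Complex.continuous_ofReal.tendsto s).comp ha).mul tendsto_const_nhds)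
  have hne : ∀ x : ℝ, (1 : ℂ) - x * Complex.I ≠ 0 := fun x h => by
    have := congrArg Complex.re h
    simp at this
  have hL : Tendsto (fun β => f β L) atTop (𝓝 (1 / (1 - s * Complex.I))) := by
    have h1 := (tendsto_const_nhds (x := (1 : ℂ)).sub herr).div hden (hne s)
    rw [sub_zero] at h1
    refine h1.congr fun β => ?_
    rw [Pi.div_apply, div_eq_iff (hne _)]
    ring
  have hvL : Tendsto (fun β => f β v - f β L) atTop (𝓝 0) := by
    refine squeeze_zero_norm' (h0.mono fun β hβ => (hf β hβ).norm_sub_le (hh β hβ) hN2 hβ v) ?_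
    simpa using (hesc.const_mul 2).add hkap
  simpa using hvL.add hL

end SocialNetwork

namespace SocialNetwork

/-! ### Exponential clocks -/

section Exponential

lemma expMeasure_eq_withDensity (r : ℝ) : expMeasure r = volume.withDensity (exponentialPDF r) :=
  rfl

lemma measurable_exponentialPDF (r : ℝ) : Measurable (exponentialPDF r) :=
  (measurable_exponentialPDFReal r).ennreal_ofReal

lemma lintegral_expMeasure (r : ℝ) {g : ℝ → ℝ≥0∞} (hg : Measurable g) :
    ∫⁻ t, g t ∂expMeasure r = ∫⁻ t, exponentialPDF r t * g t :=
  lintegral_withDensity_eq_lintegral_mul volume (measurable_exponentialPDF r) hg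

lemma expMeasure_Ici {r : ℝ} (hr : 0 < r) {s : ℝ} (hs : 0 ≤ s) :
    expMeasure r (Set.Ici s) = ENNReal.ofReal (Real.exp (-(r * s))) := by
  have := isProbabilityMeasure_expMeasure hr
  have hatom : NullSingletonClass (expMeasure r) :=
    nullSingletonClass_withDensity (μ := volume) (exponentialPDF r)
  rw [← measure_congr (Ioi_ae_eq_Ici (μ := expMeasure r) (a := s)), ← Set.compl_Iic,
    prob_compl_eq_one_sub measurableSet_Iic, ← ofReal_cdf, cdf_expMeasure_eq hr, if_pos hs,
    ← ENNReal.ofReal_one, ← ENNReal.ofReal_sub _ (by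
      have := Real.exp_le_one_iff.2 (show -(r * s) ≤ 0 by nlinarith)
      linarith)]
  ring_nf

lemma expMeasure_Iic_zero {r : ℝ} (hr : 0 < r) : expMeasure r (Set.Iic 0) = 0 := by
  have := isProbabilityMeasure_expMeasure hr
  rw [← ofReal_cdf, cdf_expMeasure_eq hr]
  simp

lemma ae_expMeasure_pos {r : ℝ} (hr : 0 < r) : ∀ᵐ t ∂expMeasure r, 0 < t := by
  rw [ae_iff]
  simpa [Set.Iic_def] using expMeasure_Iic_zero hr

lemma map_div_expMeasure {r : ℝ} (hr : 0 < r) :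
    (expMeasure 1).map (fun t => t / r) = expMeasure r := by
  have := isProbabilityMeasure_expMeasure hr
  have : IsProbabilityMeasure ((expMeasure 1).map (fun t => t / r)) :=
    Measure.isProbabilityMeasure_map (by fun_prop)
  refine Measure.ext_of_Iic _ _ fun x => ?_
  rw [Measure.map_apply (by fun_prop) measurableSet_Iic]
  have h1 : (fun t => t / r) ⁻¹' Set.Iic x = Set.Iic (r * x) := by
    ext t; simp [div_le_iff₀ hr, mul_comm]
  rw [h1, ← ofReal_cdf, ← ofReal_cdf, cdf_expMeasure_eq hr, cdf_expMeasure_eq one_pos]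
  simp [hr]

lemma lintegral_ofReal_expMeasure {r : ℝ} (hr : 0 < r) :
    ∫⁻ t, ENNReal.ofReal t ∂expMeasure r = ENNReal.ofReal (1 / r) := by
  have hint : ∫ t in Set.Ioi 0, r * (t ^ ((2 : ℝ) - 1) * Real.exp (-(r * t))) = 1 / r := by
    rw [integral_const_mul, Real.integral_rpow_mul_exp_neg_mul_Ioi two_pos hr, Real.Gamma_two,
      Real.rpow_two]
    field_simp
  rw [lintegral_expMeasure r ENNReal.measurable_ofReal, ← hint,
    ofReal_integral_eq_lintegral_ofReal (.of_integral_ne_zero (by rw [hint]; positivity))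
      ((ae_restrict_iff' measurableSet_Ioi).2 (.of_forall fun t ht => by
        have : 0 < t := ht
        positivity)), ← lintegral_indicator measurableSet_Ioi]
  refine lintegral_congr fun t => ?_
  by_cases ht : 0 < t
  · rw [Set.indicator_of_mem (Set.mem_Ioi.2 ht), exponentialPDF_of_nonneg ht.le,
      ← ENNReal.ofReal_mul (by positivity)]
    norm_num
    ring_nf
  · rw [Set.indicator_of_notMem (by simpa using ht), ENNReal.ofReal_of_nonpos (not_lt.1 ht),
      mul_zero]

lemma integral_exp_expMeasure {r : ℝ} (hr : 0 < r) (θ : ℝ) :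
    ∫ t, Complex.exp (θ * t * Complex.I) ∂expMeasure r = r / (r - θ * Complex.I) := by
  have hre : (θ * Complex.I - r : ℂ).re < 0 := by simpa using hr
  rw [expMeasure_eq_withDensity, integral_withDensity_eq_integral_toReal_smul
    (measurable_exponentialPDF r) (.of_forall fun _ => ENNReal.ofReal_lt_top)]
  have h1 : ∀ t : ℝ, (exponentialPDF r t).toReal • Complex.exp (θ * t * Complex.I) =
      (Set.Ici (0 : ℝ)).indicator
        (fun t : ℝ => (r : ℂ) * Complex.exp ((θ * Complex.I - r) * t)) t := by
    intro t
    by_cases ht : 0 ≤ t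
    · rw [Set.indicator_of_mem (Set.mem_Ici.2 ht), exponentialPDF_of_nonneg ht,
        ENNReal.toReal_ofReal (by positivity), Complex.real_smul]
      push_cast
      rw [mul_assoc, ← Complex.exp_add]
      ring_nf
    · rw [Set.indicator_of_notMem (by simpa using ht), exponentialPDF_of_neg (not_le.1 ht)]
      simp
  simp_rw [h1]
  rw [integral_indicator measurableSet_Ici, integral_Ici_eq_integral_Ioi, integral_const_mul,
    integral_exp_mul_complex_Ioi hre]
  have hne : (r - θ * Complex.I : ℂ) ≠ 0 := fun h => by
    have := congrArg Complex.re h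
    simp at this
    exact hr.ne' this
  have hne' : (θ * Complex.I - r : ℂ) ≠ 0 := fun h => hne (by linear_combination -h)
  simp only [Complex.ofReal_zero, mul_zero, Complex.exp_zero]
  field_simp
  ring

/-- In a finite family of independent exponential times, the event that the `p`-th time is the
first one has probability proportional to the rate of `p`, and on this event the first time is
exponential with the sum of the rates as parameter. -/
lemma setLIntegral_pi_expMeasure {ι : Type*} [Fintype ι] {r : ι → ℝ}
    (hr : ∀ q, 0 < r q) (p : ι) {g : ℝ → ℝ≥0∞} (hg : Measurable g) :
    ∫⁻ y in {y : ι → ℝ | ∀ q, y p ≤ y q}, g (y p) ∂(Measure.pi fun q => expMeasure (r q)) =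
      ENNReal.ofReal (r p / ∑ q, r q) * ∫⁻ t, g t ∂expMeasure (∑ q, r q) := by
  classical
  have hprob : ∀ q, IsProbabilityMeasure (expMeasure (r q)) := fun q =>
    isProbabilityMeasure_expMeasure (hr q)
  have hR : 0 < ∑ q, r q := Finset.sum_pos (fun q _ => hr q) ⟨p, Finset.mem_univ p⟩
  set A : Set (ι → ℝ) := {y | ∀ q, y p ≤ y q}
  have hA : MeasurableSet A := by
    have : A = ⋂ q, {y | y p ≤ y q} := by ext y; simp [A]
    rw [this]
    exact .iInter fun q => measurableSet_le (measurable_pi_apply p) (measurable_pi_apply q)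
  have hf : Measurable (A.indicator fun y => g (y p)) :=
    (hg.comp (measurable_pi_apply p)).indicator hA
  rw [← lintegral_indicator hA, lintegral_eq_lmarginal_univ (fun _ => 0),
    lmarginal_erase _ hf (Finset.mem_univ p)]
  have hinner : ∀ s : ℝ, (∫⋯∫⁻_Finset.univ.erase p, A.indicator (fun y => g (y p))
      ∂fun q => expMeasure (r q)) (Function.update (fun _ => 0) p s) =
      g s * ∏ q ∈ Finset.univ.erase p, expMeasure (r q) (Set.Ici s) := by
    intro s
    unfold lmarginal
    have h1 : ∀ y : ((i : (Finset.univ.erase p : Finset ι)) → ℝ),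
        A.indicator (fun y => g (y p)) (Function.updateFinset
          (Function.update (fun _ => 0) p s) (Finset.univ.erase p) y) =
        (Set.univ.pi fun _ => Set.Ici s).indicator (fun _ => g s) y := by
      intro y
      have hp : Function.updateFinset (Function.update (fun _ => (0 : ℝ)) p s)
          (Finset.univ.erase p) y p = s := by
        simp [Function.updateFinset]
      have hq : ∀ (q : ι) (h : q ∈ Finset.univ.erase p), Function.updateFinset
          (Function.update (fun _ => (0 : ℝ)) p s) (Finset.univ.erase p) y q = y ⟨q, h⟩ :=
        fun q h => by simp only [Function.updateFinset, h, dif_pos]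
      have hiff : Function.updateFinset (Function.update (fun _ => (0 : ℝ)) p s)
          (Finset.univ.erase p) y ∈ A ↔ y ∈ Set.univ.pi fun _ => Set.Ici s := by
        simp only [A, Set.mem_ofPred_eq, Set.mem_univ_pi, Set.mem_Ici, hp]
        constructor
        · intro h q
          rw [← hq q.1 q.2]
          exact h q.1
        · intro h q
          by_cases hqp : q = p
          · rw [hqp, hp]
          · rw [hq q (by simp [hqp])]
            exact h _
      by_cases hy : y ∈ Set.univ.pi fun _ => Set.Ici s
      · rw [Set.indicator_of_mem hy, Set.indicator_of_mem (hiff.2 hy), hp]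
      · rw [Set.indicator_of_notMem hy, Set.indicator_of_notMem (fun h => hy (hiff.1 h))]
    simp_rw [h1]
    rw [lintegral_indicator_const (MeasurableSet.univ_pi fun _ => measurableSet_Ici),
      Measure.pi_pi, Finset.prod_coe_sort (Finset.univ.erase p)
        (fun q => expMeasure (r q) (Set.Ici s))]
  simp_rw [hinner]
  have hprodm : Measurable fun s : ℝ =>
      g s * ∏ q ∈ Finset.univ.erase p, expMeasure (r q) (Set.Ici s) := by
    refine hg.mul (Finset.measurable_prod _ fun q _ => ?_)
    exact Antitone.measurable fun s t hst => measure_mono (Set.Ici_subset_Ici.2 hst)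
  rw [lintegral_expMeasure _ hprodm, lintegral_expMeasure _ hg,
    ← lintegral_const_mul _ (show Measurable fun t => exponentialPDF (∑ q, r q) t * g t from
      (measurable_exponentialPDF _).mul hg)]
  refine lintegral_congr fun s => ?_
  rcases lt_or_ge s 0 with hs | hs
  · rw [exponentialPDF_of_neg hs, exponentialPDF_of_neg hs]; simp
  have hprod : ∏ q ∈ Finset.univ.erase p, expMeasure (r q) (Set.Ici s) =
      ENNReal.ofReal (Real.exp (-((∑ q ∈ Finset.univ.erase p, r q) * s))) := by
    rw [Finset.sum_mul, ← Finset.sum_neg_distrib, Real.exp_sum,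
      ENNReal.ofReal_prod_of_nonneg fun _ _ => (Real.exp_pos _).le]
    exact Finset.prod_congr rfl fun q _ => expMeasure_Ici (hr q) hs
  have hsum := Finset.add_sum_erase Finset.univ r (Finset.mem_univ p)
  rw [hprod, exponentialPDF_of_nonneg hs, exponentialPDF_of_nonneg hs]
  calc _ = (ENNReal.ofReal (r p * Real.exp (-(r p * s))) *
        ENNReal.ofReal (Real.exp (-((∑ q ∈ Finset.univ.erase p, r q) * s)))) * g s := by ring
    _ = (ENNReal.ofReal (r p / ∑ q, r q) *
        ENNReal.ofReal ((∑ q, r q) * Real.exp (-((∑ q, r q) * s)))) * g s := by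
      rw [← ENNReal.ofReal_mul (by have := hr p; positivity),
        ← ENNReal.ofReal_mul (by have := hr p; positivity), mul_assoc, ← Real.exp_add, ← hsum]
      congr 2
      rw [hsum, ← mul_assoc, div_mul_cancel₀ _ hR.ne', ← hsum]
      ring_nf
    _ = _ := by ring

end Exponential

variable {N : ℕ} [NeZero N]

instance : MeasurableSingletonClass ℤˣ :=
  ⟨fun x => ⟨{(x : ℤ)}, measurableSet_singleton _, by ext; simp [Units.ext_iff]⟩⟩

lemma firstMark_le (e : Mark N → ℝ) (q : Mark N) : e (firstMark e) ≤ e q :=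
  Classical.epsilon_spec (p := fun p => ∀ q, e p ≤ e q) (Finite.exists_min e) q

lemma measurable_firstMark : Measurable (firstMark : (Mark N → ℝ) → Mark N) := by
  have h1 : (firstMark : (Mark N → ℝ) → Mark N) =
      (fun P : Mark N → Prop => Classical.epsilon P) ∘ fun e p => ∀ q, e p ≤ e q := rfl
  rw [h1]
  refine (Measurable.of_discrete).comp (measurable_pi_iff.2 fun p => ?_)
  refine measurableSet_setOfPred.1 ?_
  simp only [Set.ofPred_forall]
  exact .iInter fun q => measurableSet_le (measurable_pi_apply p) (measurable_pi_apply q)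

/-- The law of the next mark and of the time until it occurs. -/
noncomputable def stepLaw (β : ℝ) (u : PressureList N) : Measure (Mark N × ℝ) :=
  ∑ p, ENNReal.ofReal (jumpProb β u p) • (Measure.dirac p).prod (expMeasure (totalRate β u))

lemma isProbabilityMeasure_expMeasure_totalRate (β : ℝ) (u : PressureList N) :
    IsProbabilityMeasure (expMeasure (totalRate β u)) :=
  isProbabilityMeasure_expMeasure (totalRate_pos β u)

lemma setLIntegral_firstMark {r : Mark N → ℝ} (hr : ∀ q, 0 < r q) (p : Mark N) {g : ℝ → ℝ≥0∞}
    (hg : Measurable g) :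
    ∫⁻ y in {y : Mark N → ℝ | firstMark y = p}, g (y p)
      ∂(Measure.pi fun q => expMeasure (r q)) =
      ENNReal.ofReal (r p / ∑ q, r q) * ∫⁻ t, g t ∂expMeasure (∑ q, r q) := by
  have hprob : ∀ q, IsProbabilityMeasure (expMeasure (r q)) := fun q =>
    isProbabilityMeasure_expMeasure (hr q)
  have hR : 0 < ∑ q, r q := Finset.sum_pos (fun q _ => hr q) ⟨p, Finset.mem_univ p⟩
  have := isProbabilityMeasure_expMeasure hR
  set ν := Measure.pi fun q => expMeasure (r q)
  set F : Mark N → Set (Mark N → ℝ) := fun p => {y | firstMark y = p}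
  set A : Mark N → Set (Mark N → ℝ) := fun p => {y | ∀ q, y p ≤ y q}
  have hF : ∀ p, MeasurableSet (F p) := fun p => measurable_firstMark (measurableSet_singleton p)
  have hFA : ∀ p, F p ⊆ A p := fun p y hy q => by
    have : firstMark y = p := hy
    exact this ▸ firstMark_le y q
  have hA : ∀ p, ν (A p) = ENNReal.ofReal (r p / ∑ q, r q) := fun p => by
    have := setLIntegral_pi_expMeasure hr p (g := fun _ => 1) measurable_const
    simpa [ν, A] using this
  have hAsum : ∑ p, ν (A p) = 1 := by
    simp_rw [hA]
    rw [← ENNReal.ofReal_sum_of_nonneg fun q _ => (div_pos (hr q) hR).le, ← Finset.sum_div,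
      div_self hR.ne', ENNReal.ofReal_one]
  have hFsum : ∑ p, ν (F p) = 1 := by
    have h1 : (⋃ p, F p) = Set.univ := by ext y; simp [F]
    have h2 := measure_iUnion (μ := ν) (fun p q hpq => Set.disjoint_left.2 fun y hy hy' =>
      hpq (hy.symm.trans hy')) hF
    rw [h1, measure_univ, tsum_fintype] at h2
    exact h2.symm
  -- Ties are negligible, because the probabilities of the events `A p` add up to one.
  have hle : ν (A p) ≤ ν (F p) := by
    by_contra! hlt
    have : ∑ p, ν (F p) < ∑ p, ν (A p) := by
      rw [← Finset.add_sum_erase _ _ (Finset.mem_univ p),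
        ← Finset.add_sum_erase _ (fun p => ν (A p)) (Finset.mem_univ p)]
      exact ENNReal.add_lt_add_of_lt_of_le (ENNReal.sum_ne_top.2 fun _ _ => measure_ne_top _ _) hlt
        (Finset.sum_le_sum fun q _ => measure_mono (hFA q))
    rw [hFsum, hAsum] at this
    exact lt_irrefl _ this
  have hae : F p =ᵐ[ν] A p := ae_eq_of_subset_of_measure_ge (hFA p) hle
    (hF p).nullMeasurableSet (measure_ne_top _ _)
  rw [setLIntegral_congr hae]
  exact setLIntegral_pi_expMeasure hr p hg

end SocialNetwork

namespace SocialNetwork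

/-! ### The first step -/

section Shift

variable {N : ℕ}

/-- The exponential variables used after the first opinion, renumbered. -/
def shift (ω : Sample N) : Sample N := fun np => ω (np.1 + 1, np.2)

/-- The sample point with given exponential variables for the first opinion and for the later
ones. -/
def consSample (x : Mark N → ℝ) (ω : Sample N) : Sample N
  | (0, p) => x p
  | (n + 1, p) => ω (n, p)

lemma measurable_shift : Measurable (shift : Sample N → Sample N) :=
  measurable_pi_iff.2 fun _ => measurable_pi_apply _

lemma measurable_consSample :
    Measurable fun z : (Mark N → ℝ) × Sample N => consSample z.1 z.2 := by
  refine measurable_pi_iff.2 fun np => ?_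
  obtain ⟨n, p⟩ := np
  cases n with
  | zero => exact (measurable_pi_apply p).comp measurable_fst
  | succ n => exact (measurable_pi_apply (n, p)).comp measurable_snd

lemma map_consSample :
    ((Measure.pi fun _ : Mark N => expMeasure 1).prod (law N)).map
      (fun z => consSample z.1 z.2) = law N := by
  classical
  refine Measure.eq_infinitePi _ fun s t ht => ?_
  rw [Measure.map_apply measurable_consSample
    (MeasurableSet.pi s.countable_toSet fun i _ => ht i)]
  obtain ⟨s', hs'⟩ : ∃ s' : Finset (ℕ × Mark N), ∀ n p, (n, p) ∈ s' ↔ (n + 1, p) ∈ s := by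
    have he : Set.InjOn (fun np : ℕ × Mark N => (np.1 + 1, np.2))
        ((fun np : ℕ × Mark N => (np.1 + 1, np.2)) ⁻¹' s) := fun a _ b _ h => by
      simpa [Prod.ext_iff] using h
    exact ⟨s.preimage _ he, fun n p => Finset.mem_preimage (hf := he)⟩
  have hpre : (fun z : (Mark N → ℝ) × Sample N => consSample z.1 z.2) ⁻¹' (Set.pi s t) =
      (Set.univ.pi fun p => if ((0, p) : ℕ × Mark N) ∈ s then t (0, p) else Set.univ) ×ˢ
      (Set.pi s' fun np => t (np.1 + 1, np.2)) := by
    ext ⟨x, ω⟩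
    simp only [Set.mem_preimage, Set.mem_pi, Set.mem_prod, Set.mem_univ, true_imp_iff,
      Finset.mem_coe]
    constructor
    · intro h
      refine ⟨fun p => ?_, fun np hnp => h _ ((hs' _ _).1 hnp)⟩
      split_ifs with hp
      · exact h _ hp
      · trivial
    · rintro ⟨h1, h2⟩ ⟨n, p⟩ hnp
      cases n with
      | zero => have := h1 p; rwa [if_pos hnp] at this
      | succ n => exact h2 (n, p) ((hs' n p).2 hnp)
  rw [hpre, Measure.prod_prod, Measure.pi_pi, law, Measure.infinitePi_pi _ fun i _ => ht _]
  rw [← Finset.prod_filter_mul_prod_filter_not s (fun np => np.1 = 0)]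
  congr 1
  · have h1 : ∀ p : Mark N,
        expMeasure 1 (if ((0, p) : ℕ × Mark N) ∈ s then t (0, p) else Set.univ) =
        if ((0, p) : ℕ × Mark N) ∈ s then expMeasure 1 (t (0, p)) else 1 := fun p => by
      split_ifs <;> simp
    simp_rw [h1]
    rw [← Finset.prod_filter]
    refine Finset.prod_bij' (fun p _ => (0, p)) (fun np _ => np.2) ?_ ?_ ?_ ?_ ?_ <;>
      simp +contextual [Prod.ext_iff]
    rintro a b c hmem rfl
    exact hmem
  · refine Finset.prod_bij' (fun np _ => (np.1 + 1, np.2)) (fun np _ => (np.1 - 1, np.2))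
      ?_ ?_ ?_ ?_ ?_
    · rintro ⟨n, p⟩ h
      simpa using (hs' n p).1 h
    · rintro ⟨n, p⟩ h
      simp only [Finset.mem_filter] at h
      obtain ⟨k, rfl⟩ := Nat.exists_eq_succ_of_ne_zero h.2
      exact (hs' k p).2 h.1
    · simp
    · rintro ⟨n, p⟩ h
      simp only [Finset.mem_filter] at h
      obtain ⟨k, rfl⟩ := Nat.exists_eq_succ_of_ne_zero h.2
      simp
    · simp

/-- The exponential variables of the first opinion are independent of the later ones. -/
lemma measurePreserving_split :
    MeasurePreserving (fun ω : Sample N => ((fun p => ω (0, p) : Mark N → ℝ), shift ω)) (law N)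
      ((Measure.pi fun _ : Mark N => expMeasure 1).prod (law N)) := by
  have hmeas : Measurable fun ω : Sample N => ((fun p => ω (0, p) : Mark N → ℝ), shift ω) :=
    (measurable_pi_iff.2 fun _ => measurable_pi_apply _).prodMk measurable_shift
  refine ⟨hmeas, ?_⟩
  conv_lhs => rw [← map_consSample]
  rw [Measure.map_map hmeas measurable_consSample]
  convert Measure.map_id
  ext z
  · rfl
  · rfl

end Shift

variable {N : ℕ} [NeZero N]

lemma measurable_firstMark_prodMk_apply :
    Measurable fun y : Mark N → ℝ => (firstMark y, y (firstMark y)) := by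
  refine measurable_firstMark.prodMk ?_
  exact (measurable_from_prod_countable_left (f := fun z : (Mark N → ℝ) × Mark N => z.1 z.2)
    fun p => measurable_pi_apply p).comp (measurable_id.prodMk measurable_firstMark)

lemma map_firstMark (β : ℝ) (u : PressureList N) :
    (Measure.pi fun q => expMeasure (rate β u q)).map (fun y => (firstMark y, y (firstMark y))) =
      stepLaw β u := by
  have hprob : ∀ q, IsProbabilityMeasure (expMeasure (rate β u q)) := fun q =>
    isProbabilityMeasure_expMeasure (rate_pos β u q)
  have := isProbabilityMeasure_expMeasure_totalRate β u
  ext S hS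
  rw [Measure.map_apply measurable_firstMark_prodMk_apply hS]
  set ν := Measure.pi fun q => expMeasure (rate β u q)
  set S' := (fun y : Mark N → ℝ => (firstMark y, y (firstMark y))) ⁻¹' S
  have hS' : MeasurableSet S' := measurable_firstMark_prodMk_apply hS
  set F : Mark N → Set (Mark N → ℝ) := fun p => {y | firstMark y = p}
  have hF : ∀ p, MeasurableSet (F p) := fun p => measurable_firstMark (measurableSet_singleton p)
  have h1 : S' = ⋃ p, F p ∩ S' := by
    rw [← Set.iUnion_inter]
    have : (⋃ p, F p) = Set.univ := by ext y; simp [F]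
    rw [this, Set.univ_inter]
  have h2 : ∀ p, ν (F p ∩ S') =
      ENNReal.ofReal (jumpProb β u p) * expMeasure (totalRate β u) (Prod.mk p ⁻¹' S) := by
    intro p
    have hSp : MeasurableSet (Prod.mk p ⁻¹' S) := measurable_prodMk_left hS
    have h3 := setLIntegral_firstMark (fun q => rate_pos β u q) p
      (g := (Prod.mk p ⁻¹' S).indicator 1) (measurable_one.indicator hSp)
    rw [lintegral_indicator_one hSp] at h3
    refine Eq.trans ?_ h3
    rw [← lintegral_indicator (hF p), ← lintegral_indicator_one ((hF p).inter hS')]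
    refine lintegral_congr fun y => ?_
    by_cases hy : y ∈ F p
    · have hy' : firstMark y = p := hy
      have : y ∈ S' ↔ y p ∈ Prod.mk p ⁻¹' S := by simp [S', hy']
      by_cases hyS : y ∈ S'
      · rw [Set.indicator_of_mem (show y ∈ F p ∩ S' from ⟨hy, hyS⟩), Set.indicator_of_mem hy,
          Set.indicator_of_mem (this.1 hyS)]; rfl
      · rw [Set.indicator_of_notMem fun h => hyS h.2, Set.indicator_of_mem hy,
          Set.indicator_of_notMem fun h => hyS (this.2 h)]
    · rw [Set.indicator_of_notMem fun h => hy h.1, Set.indicator_of_notMem hy]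
  rw [h1, measure_iUnion (fun p q hpq => Set.disjoint_left.2 fun y hy hy' =>
    hpq (hy.1.symm.trans hy'.1)) fun p => (hF p).inter hS', tsum_fintype]
  simp only [h2, stepLaw, Measure.coe_finsetSum, Finset.sum_apply, Measure.smul_apply,
    smul_eq_mul]
  refine Finset.sum_congr rfl fun p _ => ?_
  rw [Measure.prod_apply hS, lintegral_dirac' _ (measurable_measure_prodMk_left hS)]

/-- The time of the first opinion. -/
noncomputable def firstTime (β : ℝ) (u : PressureList N) (ω : Sample N) : ℝ :=
  clock β 0 u ω (mark β u ω 0)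

instance isProbabilityMeasure_stepLaw (β : ℝ) (u : PressureList N) :
    IsProbabilityMeasure (stepLaw β u) := by
  have : ∀ q, IsProbabilityMeasure (expMeasure (rate β u q)) := fun q =>
    isProbabilityMeasure_expMeasure (rate_pos β u q)
  rw [← map_firstMark]
  exact Measure.isProbabilityMeasure_map measurable_firstMark_prodMk_apply.aemeasurable

/-- The Markov property at the first opinion. -/
lemma measurePreserving_firstStep (β : ℝ) (u : PressureList N) :
    MeasurePreserving (fun ω : Sample N => ((mark β u ω 0, firstTime β u ω), shift ω)) (law N)
      ((stepLaw β u).prod (law N)) := by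
  have hprob : ∀ q, IsProbabilityMeasure (expMeasure (rate β u q)) := fun q =>
    isProbabilityMeasure_expMeasure (rate_pos β u q)
  have hscale : Measurable fun (x : Mark N → ℝ) p => x p / rate β u p := by fun_prop
  have hhead : MeasurePreserving (fun x : Mark N → ℝ => ((firstMark fun p => x p / rate β u p),
      (fun p => x p / rate β u p) (firstMark fun p => x p / rate β u p)))
      (Measure.pi fun _ => expMeasure 1) (stepLaw β u) := by
    refine MeasurePreserving.comp
      (g := fun y : Mark N → ℝ => (firstMark y, y (firstMark y)))
      (f := fun (x : Mark N → ℝ) p => x p / rate β u p)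
      ⟨measurable_firstMark_prodMk_apply, map_firstMark β u⟩ ⟨hscale, ?_⟩
    have : ∀ q, SigmaFinite ((expMeasure 1).map fun t => t / rate β u q) := fun q => by
      rw [map_div_expMeasure (rate_pos β u q)]; infer_instance
    rw [Measure.pi_map_pi (f := fun q t => t / rate β u q) fun q => by fun_prop]
    simp_rw [map_div_expMeasure (rate_pos β u _)]
  exact (hhead.prod (MeasurePreserving.id (law N))).comp measurePreserving_split

lemma lintegral_firstStep (β : ℝ) (u : PressureList N) {G : (Mark N × ℝ) × Sample N → ℝ≥0∞}
    (hG : Measurable G) :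
    ∫⁻ ω, G ((mark β u ω 0, firstTime β u ω), shift ω) ∂law N =
      ∑ p, ENNReal.ofReal (jumpProb β u p) *
        ∫⁻ t, ∫⁻ ω, G ((p, t), ω) ∂law N ∂expMeasure (totalRate β u) := by
  have := isProbabilityMeasure_expMeasure_totalRate β u
  rw [(measurePreserving_firstStep β u).lintegral_comp hG, lintegral_prod _ hG.aemeasurable,
    stepLaw, lintegral_finsetSum_measure]
  refine Finset.sum_congr rfl fun p _ => ?_
  have hm : Measurable fun z => ∫⁻ ω, G (z, ω) ∂law N := hG.lintegral_prod_right'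
  rw [lintegral_smul_measure, lintegral_prod _ hm.aemeasurable,
    lintegral_dirac' _ hm.lintegral_prod_right', smul_eq_mul]

lemma integral_firstStep (β : ℝ) (u : PressureList N) {G : (Mark N × ℝ) × Sample N → ℂ}
    (hG : Measurable G) (hb : ∀ z, ‖G z‖ ≤ 1) :
    ∫ ω, G ((mark β u ω 0, firstTime β u ω), shift ω) ∂law N =
      ∑ p, (jumpProb β u p : ℂ) *
        ∫ t, ∫ ω, G ((p, t), ω) ∂law N ∂expMeasure (totalRate β u) := by
  have := isProbabilityMeasure_expMeasure_totalRate β u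
  have hmp := measurePreserving_firstStep β u
  have hint : Integrable G ((stepLaw β u).prod (law N)) :=
    .of_bound hG.aestronglyMeasurable 1 (.of_forall hb)
  have hm : StronglyMeasurable fun z => ∫ ω, G (z, ω) ∂law N :=
    hG.stronglyMeasurable.integral_prod_right'
  have hb' : ∀ z, ‖∫ ω, G (z, ω) ∂law N‖ ≤ 1 := fun z =>
    (norm_integral_le_of_norm_le_const (.of_forall fun ω => hb (z, ω))).trans (by simp)
  rw [← integral_map (f := G) hmp.measurable.aemeasurable hG.aestronglyMeasurable, hmp.map_eq,
    integral_prod _ hint, stepLaw, integral_finsetSum_measure fun p _ =>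
      (Integrable.of_bound hm.aestronglyMeasurable 1 (.of_forall hb')).smul_measure
        ENNReal.ofReal_ne_top]
  refine Finset.sum_congr rfl fun p _ => ?_
  rw [integral_smul_measure, Measure.dirac_prod,
    integral_map measurable_prodMk_left.aemeasurable hm.aestronglyMeasurable,
    ENNReal.toReal_ofReal (jumpProb_nonneg β u p), Complex.real_smul]

end SocialNetwork

namespace SocialNetwork

variable {N : ℕ}

/-! ### The hitting time of the negative consensus -/

lemma ae_pos : ∀ᵐ ω ∂law N, ∀ i, 0 < ω i :=
  ae_all_iff.2 fun i => (measurePreserving_eval_infinitePi (fun _ => expMeasure 1)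
    i).quasiMeasurePreserving.ae (ae_expMeasure_pos one_pos)

lemma clock_pos {β : ℝ} {n : ℕ} {u : PressureList N} {ω : Sample N} (hω : ∀ i, 0 < ω i)
    (p : Mark N) : 0 < clock β n u ω p :=
  div_pos (hω _) (rate_pos β u p)

lemma sum_ofReal_jumpProb_mul (β : ℝ) (u : PressureList N) {g : PressureList N → ℝ}
    (hg : ∀ w, 0 ≤ g w) :
    ∑ p, ENNReal.ofReal (jumpProb β u p) * ENNReal.ofReal (g (express p u)) =
      ENNReal.ofReal (avg β g u) := by
  unfold avg
  rw [ENNReal.ofReal_sum_of_nonneg fun p _ => smul_nonneg (jumpProb_nonneg β u p) (hg _)]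
  refine Finset.sum_congr rfl fun p _ => ?_
  rw [smul_eq_mul, ENNReal.ofReal_mul (jumpProb_nonneg β u p)]

lemma measurable_comp_express {γ : Type*} [MeasurableSpace γ] {F : PressureList N → Sample N → γ}
    (hF : ∀ w, Measurable (F w)) (u : PressureList N) :
    Measurable fun z : (Mark N × ℝ) × Sample N => F (express z.1.1 u) z.2 := by
  have : Measurable fun z : Mark N × Sample N => F (express z.1 u) z.2 :=
    measurable_from_prod_countable_right fun p => hF (express p u)
  exact this.comp (measurable_fst.fst.prodMk measurable_snd)

lemma measurable_comp_firstStep {F : PressureList N → Sample N → ℝ≥0∞}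
    (hF : ∀ w, Measurable (F w)) (u : PressureList N) :
    Measurable fun z : (Mark N × ℝ) × Sample N =>
      ENNReal.ofReal z.1.2 + F (express z.1.1 u) z.2 :=
  measurable_fst.snd.ennreal_ofReal.add (measurable_comp_express hF u)

variable [NeZero N]

lemma chain_succ' (β : ℝ) (u : PressureList N) (ω : Sample N) (n : ℕ) :
    chain β u ω (n + 1) = chain β (express (mark β u ω 0) u) (shift ω) n := by
  induction n with
  | zero => rfl
  | succ n ih =>
    change express (firstMark (clock β (n + 1) (chain β u ω (n + 1)) ω)) (chain β u ω (n + 1)) = _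
    rw [ih]
    rfl

lemma jumpTime_succ' (β : ℝ) (u : PressureList N) (ω : Sample N) (n : ℕ) :
    jumpTime β u ω (n + 1) =
      firstTime β u ω + jumpTime β (express (mark β u ω 0) u) (shift ω) n := by
  induction n with
  | zero => simp [jumpTime, firstTime, chain]
  | succ n ih =>
    have h : clock β (n + 1) (chain β u ω (n + 1)) ω (mark β u ω (n + 1)) =
        clock β n (chain β (express (mark β u ω 0) u) (shift ω) n) (shift ω)
          (mark β (express (mark β u ω 0) u) (shift ω) n) := by
      unfold mark
      rw [chain_succ' β u ω n]
      rfl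
    rw [jumpTime, ih, h, jumpTime, add_assoc]

lemma measurable_chain (β : ℝ) (u : PressureList N) (n : ℕ) :
    Measurable fun ω : Sample N => chain β u ω n := by
  induction n with
  | zero => exact measurable_const
  | succ n ih =>
    have h : Measurable fun z : PressureList N × Sample N =>
        express (firstMark (clock β n z.1 z.2)) z.1 := by
      refine measurable_from_prod_countable_right fun w => ?_
      have h1 : Measurable fun ω : Sample N => clock β n w ω :=
        measurable_pi_iff.2 fun p => (measurable_pi_apply (n, p)).div_const _
      exact (Measurable.of_discrete (f := fun p => express p w)).comp
        (measurable_firstMark.comp h1)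
    exact h.comp (ih.prodMk measurable_id)

lemma measurable_jumpTime (β : ℝ) (u : PressureList N) (n : ℕ) :
    Measurable fun ω : Sample N => jumpTime β u ω n := by
  induction n with
  | zero => exact measurable_const
  | succ n ih =>
    have h : Measurable fun z : PressureList N × Sample N =>
        clock β n z.1 z.2 (firstMark (clock β n z.1 z.2)) := by
      refine measurable_from_prod_countable_right fun w => ?_
      have h1 : Measurable fun ω : Sample N => clock β n w ω :=
        measurable_pi_iff.2 fun p => (measurable_pi_apply (n, p)).div_const _
      exact measurable_firstMark_prodMk_apply.snd.comp h1
    exact ih.add (h.comp ((measurable_chain β u n).prodMk measurable_id))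

open Classical in
/-- The time of the first opinion after which the list is a negative consensus, being `0` if the
initial list is one. -/
noncomputable def hitTime (β : ℝ) (u : PressureList N) (ω : Sample N) : ℝ≥0∞ :=
  ⨅ n, if chain β u ω n ∈ negativeConsensus N then ENNReal.ofReal (jumpTime β u ω n) else ∞

lemma measurable_hitTime (β : ℝ) (u : PressureList N) :
    Measurable fun ω : Sample N => hitTime β u ω := by
  classical
  refine .iInf fun n => ?_
  exact Measurable.ite (measurable_chain β u n (Set.to_countable _).measurableSet)
    (measurable_jumpTime β u n).ennreal_ofReal measurable_const

lemma hitTime_of_mem {β : ℝ} {u : PressureList N} (hu : u ∈ negativeConsensus N) (ω : Sample N) :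
    hitTime β u ω = 0 := by
  refine le_antisymm ((iInf_le _ 0).trans ?_) bot_le
  simp [chain, jumpTime, hu]

lemma jumpTime_nonneg {β : ℝ} {u : PressureList N} {ω : Sample N} (hω : ∀ i, 0 < ω i) (n : ℕ) :
    0 ≤ jumpTime β u ω n := by
  induction n with
  | zero => exact le_rfl
  | succ n ih => exact add_nonneg ih (clock_pos hω _).le

lemma strictMono_jumpTime {β : ℝ} {u : PressureList N} {ω : Sample N} (hω : ∀ i, 0 < ω i) :
    StrictMono (jumpTime β u ω) :=
  strictMono_nat_of_lt_succ fun _ => lt_add_of_pos_right _ (clock_pos hω _)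

lemma hitTime_succ {β : ℝ} {u : PressureList N} (hu : u ∉ negativeConsensus N) {ω : Sample N}
    (hω : ∀ i, 0 < ω i) :
    hitTime β u ω = ENNReal.ofReal (firstTime β u ω) +
      hitTime β (express (mark β u ω 0) u) (shift ω) := by
  unfold hitTime
  rw [ENNReal.add_iInf, ← inf_iInf_nat_succ]
  have h0 : chain β u ω 0 ∉ negativeConsensus N := hu
  rw [if_neg h0, top_inf_eq]
  refine iInf_congr fun n => ?_
  rw [chain_succ', jumpTime_succ']
  split_ifs
  · exact ENNReal.ofReal_add (clock_pos hω _).le (jumpTime_nonneg (fun i => hω _) n)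
  · simp

lemma reachingTime_eq_hitTime {β : ℝ} {u : PressureList N} (hu : u ∉ negativeConsensus N)
    {ω : Sample N} (hω : ∀ i, 0 < ω i) :
    reachingTime β u (negativeConsensus N) ω = hitTime β u ω := by
  classical
  have hmono : StrictMono (jumpTime β u ω) := strictMono_jumpTime hω
  refine le_antisymm (le_iInf fun n => ?_) (le_iInf₂ fun t ht => ?_)
  · split_ifs with hn
    · have hn0 : n ≠ 0 := by rintro rfl; exact hu hn
      refine iInf₂_le_of_le (jumpTime β u ω n) ⟨hmono (Nat.pos_of_ne_zero hn0), _, hn, ?_⟩ le_rfl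
      have hex : ∃ m, jumpTime β u ω m ≤ jumpTime β u ω n ∧
          jumpTime β u ω n < jumpTime β u ω (m + 1) := ⟨n, le_rfl, hmono (Nat.lt_succ_self n)⟩
      have hfind : Nat.find hex = n := by
        obtain ⟨h1, h2⟩ := Nat.find_spec hex
        have h1' := hmono.le_iff_le.1 h1
        have h2' := hmono.lt_iff_lt.1 h2
        omega
      rw [pressureAt, dif_pos hex, hfind]
    · exact le_top
  · obtain ⟨-, w, hw, hp⟩ := ht
    unfold pressureAt at hp
    split_ifs at hp with hex
    refine (iInf_le _ (Nat.find hex)).trans ?_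
    rw [Option.some.inj hp, if_pos hw]
    exact ENNReal.ofReal_le_ofReal (Nat.find_spec hex).1

lemma reachingTime_ae_eq {β : ℝ} {u : PressureList N} (hu : u ∉ negativeConsensus N) :
    reachingTime β u (negativeConsensus N) =ᵐ[law N] hitTime β u :=
  ae_pos.mono fun _ hω => reachingTime_eq_hitTime hu hω

/-! ### Almost sure hitting -/

lemma ae_hits (hN : 2 ≤ N) {β : ℝ} (hβ : 0 ≤ β) (u : PressureList N) :
    ∀ᵐ ω ∂law N, ∃ n, chain β u ω n ∈ negativeConsensus N := by
  set E : PressureList N → Set (Sample N) := fun w =>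
    {ω | ∀ n, chain β w ω n ∉ negativeConsensus N}
  have hE : ∀ w, MeasurableSet (E w) := fun w => by
    have : E w = ⋂ n, (fun ω => chain β w ω n) ⁻¹' (negativeConsensus N)ᶜ := by
      ext ω; simp [E]
    rw [this]
    exact .iInter fun n => measurable_chain β w n (Set.to_countable _).measurableSet
  set g : PressureList N → ℝ := fun w => (law N (E w)).toReal
  have hg0 : ∀ w, 0 ≤ g w := fun w => ENNReal.toReal_nonneg
  have hgE : ∀ w, law N (E w) = ENNReal.ofReal (g w) := fun w =>
    (ENNReal.ofReal_toReal (measure_ne_top _ _)).symm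
  have hstep : ∀ w ∉ negativeConsensus N, g w = avg β g w := by
    intro w hw
    have := isProbabilityMeasure_expMeasure_totalRate β w
    have hG : Measurable fun z : (Mark N × ℝ) × Sample N =>
        (E (express z.1.1 w)).indicator (1 : Sample N → ℝ≥0∞) z.2 :=
      measurable_comp_express (fun x => measurable_one.indicator (hE x)) w
    have h1 := lintegral_firstStep β w hG
    have h2 : ∀ ω, (E (express (mark β w ω 0) w)).indicator (1 : Sample N → ℝ≥0∞) (shift ω) =
        (E w).indicator 1 ω := by
      intro ω
      have : shift ω ∈ E (express (mark β w ω 0) w) ↔ ω ∈ E w := by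
        constructor
        · intro h n
          cases n with
          | zero => exact hw
          | succ n => rw [chain_succ']; exact h n
        · intro h n
          rw [← chain_succ']
          exact h (n + 1)
      by_cases h : ω ∈ E w
      · rw [Set.indicator_of_mem h, Set.indicator_of_mem (this.2 h)]; rfl
      · rw [Set.indicator_of_notMem h, Set.indicator_of_notMem (fun h' => h (this.1 h'))]
    simp only [h2, lintegral_indicator_one (hE _), lintegral_const, measure_univ, mul_one,
      hgE] at h1
    rw [sum_ofReal_jumpProb_mul β w hg0] at h1
    refine (ENNReal.ofReal_eq_ofReal_iff (hg0 w) ?_).1 h1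
    exact Finset.sum_nonneg fun p _ => smul_nonneg (jumpProb_nonneg β w p) (hg0 _)
  have hzero : g u = 0 := by
    refine eq_zero_of_norm_le_avg (β := β) hN hβ (D := g) ⟨1, ?_⟩ ?_ ?_ u
    · rintro _ ⟨w, rfl⟩
      change |g w| ≤ 1
      rw [abs_of_nonneg (hg0 w)]
      exact ENNReal.toReal_le_of_le_ofReal zero_le_one (by simpa using prob_le_one)
    · intro w hw
      have : E w = ∅ := Set.eq_empty_of_forall_notMem fun ω h => h 0 hw
      simp [g, this]
    · intro w hw
      refine (congrArg norm (hstep w hw)).le.trans (norm_avg_le β g w)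
  rw [ae_iff]
  have h3 : {ω | ¬∃ n, chain β u ω n ∈ negativeConsensus N} = E u := by ext ω; simp [E]
  rw [h3, hgE, hzero, ENNReal.ofReal_zero]

/-! ### The mean hitting time -/

open Classical in
/-- The smaller one of the hitting time and the time of the `n`-th opinion, defined by recursion on
the first step. -/
noncomputable def truncatedHitTime (β : ℝ) : ℕ → PressureList N → Sample N → ℝ≥0∞
  | 0, _, _ => 0
  | n + 1, u, ω => if u ∈ negativeConsensus N then 0 else
      ENNReal.ofReal (firstTime β u ω) +
        truncatedHitTime β n (express (mark β u ω 0) u) (shift ω)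

lemma lintegral_comp_firstStep (β : ℝ) {F : PressureList N → Sample N → ℝ≥0∞}
    (hF : ∀ w, Measurable (F w)) (u : PressureList N) :
    ∫⁻ ω, (ENNReal.ofReal (firstTime β u ω) + F (express (mark β u ω 0) u) (shift ω)) ∂law N =
      ENNReal.ofReal (1 / totalRate β u) +
        ∑ p, ENNReal.ofReal (jumpProb β u p) * ∫⁻ ω, F (express p u) ω ∂law N := by
  have := isProbabilityMeasure_expMeasure_totalRate β u
  rw [lintegral_firstStep β u (measurable_comp_firstStep hF u)]
  have h1 : ∀ p : Mark N, ∫⁻ t, ∫⁻ ω, (ENNReal.ofReal t + F (express p u) ω) ∂law N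
      ∂expMeasure (totalRate β u) =
      ENNReal.ofReal (1 / totalRate β u) + ∫⁻ ω, F (express p u) ω ∂law N := fun p => by
    simp_rw [lintegral_add_left measurable_const, lintegral_const, measure_univ, mul_one]
    rw [lintegral_add_right _ measurable_const, lintegral_ofReal_expMeasure (totalRate_pos β u),
      lintegral_const, measure_univ, mul_one]
  simp only [h1, mul_add, Finset.sum_add_distrib]
  rw [← Finset.sum_mul, ← ENNReal.ofReal_sum_of_nonneg fun p _ => jumpProb_nonneg β u p,
    sum_jumpProb, ENNReal.ofReal_one, one_mul]

lemma measurable_truncatedHitTime (β : ℝ) (n : ℕ) (u : PressureList N) :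
    Measurable (truncatedHitTime β n u) := by
  induction n generalizing u with
  | zero => exact measurable_const
  | succ n ih =>
    by_cases hu : u ∈ negativeConsensus N
    · simp only [truncatedHitTime, hu, if_true]; exact measurable_const
    · simp only [truncatedHitTime, hu, if_false]
      exact (measurable_comp_firstStep ih u).comp (measurePreserving_firstStep β u).measurable

lemma truncatedHitTime_le_succ (β : ℝ) (n : ℕ) (u : PressureList N) (ω : Sample N) :
    truncatedHitTime β n u ω ≤ truncatedHitTime β (n + 1) u ω := by
  induction n generalizing u ω with
  | zero => exact bot_le
  | succ n ih =>
    rw [truncatedHitTime, truncatedHitTime]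
    split_ifs
    · exact le_rfl
    · exact add_le_add le_rfl (ih _ _)

lemma hitTime_le_truncatedHitTime {β : ℝ} {n : ℕ} {u : PressureList N} {ω : Sample N}
    (hω : ∀ i, 0 < ω i) (hn : chain β u ω n ∈ negativeConsensus N) :
    hitTime β u ω ≤ truncatedHitTime β n u ω := by
  induction n generalizing u ω with
  | zero => rw [hitTime_of_mem (u := u) hn]; exact bot_le
  | succ n ih =>
    by_cases hu : u ∈ negativeConsensus N
    · rw [hitTime_of_mem hu]; exact bot_le
    · rw [hitTime_succ hu hω, truncatedHitTime, if_neg hu]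
      exact add_le_add le_rfl (ih (fun i => hω _) (by rwa [← chain_succ']))

/-- The maximum principle bounds the means of the truncated hitting times. -/
lemma exists_lintegral_truncatedHitTime_le (hN : 2 ≤ N) {β : ℝ} (hβ : 0 ≤ β) :
    ∃ C : ℝ, ∀ n (u : PressureList N),
      ∫⁻ ω, truncatedHitTime β n u ω ∂law N ≤ ENNReal.ofReal C := by
  classical
  obtain ⟨c, hc, hc1, hr⟩ := exists_reaches_negativeConsensus (N := N) hN hβ
  set G : ℕ → PressureList N → ℝ≥0∞ := fun n u => ∫⁻ ω, truncatedHitTime β n u ω ∂law N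
  have hG0 : ∀ n, ∀ u ∈ negativeConsensus N, G n u = 0 := by
    intro n u hu
    cases n with
    | zero => simp [G, truncatedHitTime]
    | succ n => simp [G, truncatedHitTime, hu]
  have hGstep : ∀ n, ∀ u ∉ negativeConsensus N, G (n + 1) u = ENNReal.ofReal (1 / totalRate β u) +
      ∑ p, ENNReal.ofReal (jumpProb β u p) * G n (express p u) := by
    intro n u hu
    simp only [G, truncatedHitTime, hu, if_false]
    exact lintegral_comp_firstStep β (measurable_truncatedHitTime β n) u
  have hGle : ∀ n u, G n u ≤ ENNReal.ofReal n := by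
    intro n
    induction n with
    | zero => intro u; simp [G, truncatedHitTime]
    | succ n ih =>
      intro u
      by_cases hu : u ∈ negativeConsensus N
      · rw [hG0 _ _ hu]; exact bot_le
      rw [hGstep n u hu, Nat.cast_succ, add_comm, ENNReal.ofReal_add (by positivity) zero_le_one]
      refine add_le_add ?_ ?_
      · calc _ ≤ ∑ p, ENNReal.ofReal (jumpProb β u p) * ENNReal.ofReal n :=
              Finset.sum_le_sum fun p _ => mul_le_mul_right (ih _) _
          _ = _ := by
              rw [sum_ofReal_jumpProb_mul β u (g := fun _ => (n : ℝ)) fun _ => by positivity,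
                avg_const]
      · refine ENNReal.ofReal_le_ofReal ?_
        rw [div_le_one (totalRate_pos β u)]
        exact one_le_totalRate hβ u
  set g : ℕ → PressureList N → ℝ := fun n u => (G n u).toReal
  have hg0 : ∀ n u, 0 ≤ g n u := fun n u => ENNReal.toReal_nonneg
  have hGtop : ∀ n u, G n u ≠ ∞ := fun n u => ((hGle n u).trans_lt ENNReal.ofReal_lt_top).ne
  have hGg : ∀ n u, G n u = ENNReal.ofReal (g n u) := fun n u =>
    (ENNReal.ofReal_toReal (hGtop n u)).symm
  refine ⟨(N + (N + 1) : ℕ) * 1 / c ^ (N + (N + 1)), fun n u => ?_⟩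
  change G n u ≤ _
  rw [hGg]
  refine ENNReal.ofReal_le_ofReal ?_
  refine le_of_le_avg (β := β) hc hc1 zero_le_one hr ⟨n, ?_⟩ ?_ ?_ u
  · rintro _ ⟨w, rfl⟩
    exact ENNReal.toReal_le_of_le_ofReal (by positivity) (hGle n w)
  · intro w hw
    simp [g, hG0 n w hw]
  · intro w hw
    have h1 : G n w ≤ G (n + 1) w := lintegral_mono fun ω => truncatedHitTime_le_succ β n w ω
    have havg : 0 ≤ avg β (g n) w :=
      Finset.sum_nonneg fun p _ => smul_nonneg (jumpProb_nonneg β w p) (hg0 n _)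
    rw [hGstep n w hw] at h1
    simp_rw [hGg] at h1
    have hZ := totalRate_pos β w
    rw [sum_ofReal_jumpProb_mul β w (hg0 n), ← ENNReal.ofReal_add (by positivity) havg,
      ENNReal.ofReal_le_ofReal_iff (by positivity)] at h1
    have h2 : 1 / totalRate β w ≤ 1 := by
      rw [div_le_one hZ]; exact one_le_totalRate hβ w
    linarith

/-- The mean of the hitting time. -/
noncomputable def meanHitTime (β : ℝ) (u : PressureList N) : ℝ≥0∞ := ∫⁻ ω, hitTime β u ω ∂law N

lemma exists_meanHitTime_le (hN : 2 ≤ N) {β : ℝ} (hβ : 0 ≤ β) :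
    ∃ C : ℝ, ∀ u : PressureList N, meanHitTime β u ≤ ENNReal.ofReal C := by
  obtain ⟨C, hC⟩ := exists_lintegral_truncatedHitTime_le (N := N) hN hβ
  refine ⟨C, fun u => ?_⟩
  calc meanHitTime β u ≤ ∫⁻ ω, ⨆ n, truncatedHitTime β n u ω ∂law N := by
        refine lintegral_mono_ae ?_
        filter_upwards [ae_pos, ae_hits hN hβ u] with ω hω hn
        obtain ⟨n, hn⟩ := hn
        exact (hitTime_le_truncatedHitTime hω hn).trans
          (le_iSup (fun n => truncatedHitTime β n u ω) n)
    _ = ⨆ n, ∫⁻ ω, truncatedHitTime β n u ω ∂law N :=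
        lintegral_iSup (fun n => measurable_truncatedHitTime β n u)
          (monotone_nat_of_le_succ fun n ω => truncatedHitTime_le_succ β n u ω)
    _ ≤ _ := iSup_le fun n => hC n u

lemma meanHitTime_ne_top (hN : 2 ≤ N) {β : ℝ} (hβ : 0 ≤ β) (u : PressureList N) :
    meanHitTime β u ≠ ∞ := by
  obtain ⟨C, hC⟩ := exists_meanHitTime_le (N := N) hN hβ
  exact ((hC u).trans_lt ENNReal.ofReal_lt_top).ne

lemma isHittingMean (hN : 2 ≤ N) {β : ℝ} (hβ : 0 ≤ β) :
    IsHittingMean β fun u : PressureList N => (meanHitTime β u).toReal where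
  bddAbove := by
    obtain ⟨C, hC⟩ := exists_meanHitTime_le (N := N) hN hβ
    refine ⟨max C 0, ?_⟩
    rintro _ ⟨u, rfl⟩
    exact ENNReal.toReal_le_of_le_ofReal (le_max_right _ _)
      ((hC u).trans (ENNReal.ofReal_le_ofReal (le_max_left _ _)))
  nonneg u := ENNReal.toReal_nonneg
  zero u hu := by simp [meanHitTime, hitTime_of_mem hu]
  step u hu := by
    have h1 : meanHitTime β u = ENNReal.ofReal (1 / totalRate β u) +
        ∑ p, ENNReal.ofReal (jumpProb β u p) * meanHitTime β (express p u) := by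
      unfold meanHitTime
      rw [← lintegral_comp_firstStep β (measurable_hitTime β) u]
      exact lintegral_congr_ae (ae_pos.mono fun ω hω => hitTime_succ hu hω)
    have h2 : ∀ w : PressureList N, meanHitTime β w = ENNReal.ofReal (meanHitTime β w).toReal :=
      fun w => (ENNReal.ofReal_toReal (meanHitTime_ne_top hN hβ w)).symm
    have hZ := totalRate_pos β u
    have h3 : ∑ p, ENNReal.ofReal (jumpProb β u p) * meanHitTime β (express p u) =
        ENNReal.ofReal (avg β (fun w => (meanHitTime β w).toReal) u) := by
      rw [← sum_ofReal_jumpProb_mul β u fun _ => ENNReal.toReal_nonneg]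
      exact Finset.sum_congr rfl fun p _ => by rw [← h2]
    have havg : 0 ≤ avg β (fun w : PressureList N => (meanHitTime β w).toReal) u :=
      Finset.sum_nonneg fun p _ => smul_nonneg (jumpProb_nonneg β u p) ENNReal.toReal_nonneg
    rw [h3, ← ENNReal.ofReal_add (by positivity) havg] at h1
    rw [h1, ENNReal.toReal_ofReal (by positivity)]

end SocialNetwork

namespace SocialNetwork

variable {N : ℕ} [NeZero N]

/-! ### The characteristic function of the hitting time -/

/-- The characteristic function of the hitting time. -/
noncomputable def hitCharFun (β θ : ℝ) (u : PressureList N) : ℂ :=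
  ∫ ω, Complex.exp (θ * (hitTime β u ω).toReal * Complex.I) ∂law N

lemma norm_exp_mul_I (θ x : ℝ) : ‖Complex.exp (θ * x * Complex.I)‖ = 1 := by
  exact_mod_cast Complex.norm_exp_ofReal_mul_I (θ * x)

lemma ae_hitTime_lt_top (hN : 2 ≤ N) {β : ℝ} (hβ : 0 ≤ β) (u : PressureList N) :
    ∀ᵐ ω ∂law N, hitTime β u ω < ∞ :=
  ae_lt_top (measurable_hitTime β u) (meanHitTime_ne_top hN hβ u)

lemma hitCharFun_step (hN : 2 ≤ N) {β : ℝ} (hβ : 0 ≤ β) (θ : ℝ) {u : PressureList N}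
    (hu : u ∉ negativeConsensus N) :
    hitCharFun β θ u = totalRate β u / (totalRate β u - θ * Complex.I) *
      avg β (hitCharFun β θ) u := by
  have := isProbabilityMeasure_expMeasure_totalRate β u
  set G : (Mark N × ℝ) × Sample N → ℂ := fun z => Complex.exp (θ * z.1.2 * Complex.I) *
    Complex.exp (θ * (hitTime β (express z.1.1 u) z.2).toReal * Complex.I)
  have hexp : Measurable fun x : ℝ => Complex.exp (θ * x * Complex.I) := by fun_prop
  have hG : Measurable G :=
    (hexp.comp measurable_fst.snd).mul (hexp.comp
      (measurable_comp_express (F := fun w ω => (hitTime β w ω).toReal)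
        (fun w => (measurable_hitTime β w).ennreal_toReal) u))
  have hbound : ∀ z, ‖G z‖ ≤ 1 := fun z => by
    rw [norm_mul, norm_exp_mul_I, norm_exp_mul_I, one_mul]
  have h1 : hitCharFun β θ u =
      ∫ ω, G ((mark β u ω 0, firstTime β u ω), shift ω) ∂law N := by
    refine integral_congr_ae ?_
    filter_upwards [ae_pos, ae_hitTime_lt_top hN hβ u] with ω hω hfin
    rw [hitTime_succ hu hω] at hfin
    rw [hitTime_succ hu hω, ENNReal.toReal_add ENNReal.ofReal_ne_top
      (ENNReal.add_lt_top.1 hfin).2.ne, ENNReal.toReal_ofReal (show 0 ≤ firstTime β u ω from (clock_pos hω _).le)]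
    simp only [G]
    rw [← Complex.exp_add]
    push_cast
    ring_nf
  have h2 : ∀ p : Mark N, ∫ t, ∫ ω, G ((p, t), ω) ∂law N ∂expMeasure (totalRate β u) =
      totalRate β u / (totalRate β u - θ * Complex.I) * hitCharFun β θ (express p u) := by
    intro p
    rw [← integral_exp_expMeasure (totalRate_pos β u) θ, ← integral_mul_const]
    refine integral_congr_ae (.of_forall fun t => ?_)
    simp only [G, integral_const_mul]
    rfl
  rw [h1, integral_firstStep β u hG hbound, avg, Finset.mul_sum]
  refine Finset.sum_congr rfl fun p _ => ?_
  rw [h2, Complex.real_smul]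
  ring

lemma isHittingCharFun (hN : 2 ≤ N) {β : ℝ} (hβ : 0 ≤ β) (θ : ℝ) :
    IsHittingCharFun β θ (hitCharFun β θ : PressureList N → ℂ) where
  norm_le u := (norm_integral_le_of_norm_le_const
    (.of_forall fun ω => (norm_exp_mul_I θ _).le)).trans (by simp)
  one u hu := by simp [hitCharFun, hitTime_of_mem hu]
  step u hu := by
    have hZ : (totalRate β u : ℂ) ≠ 0 := by exact_mod_cast (totalRate_pos β u).ne'
    have hne : (totalRate β u - θ * Complex.I : ℂ) ≠ 0 := fun h => by
      have := congrArg Complex.re h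
      simp at this
      exact (totalRate_pos β u).ne' this
    have h := hitCharFun_step hN hβ θ hu
    rw [div_mul_eq_mul_div, eq_div_iff hne] at h
    field_simp
    linear_combination h

/-! ### Convergence in distribution -/

lemma charFun_map_div_mean (β : ℝ) (v : PressureList N) (c s : ℝ) :
    charFun ((law N).map fun ω => (hitTime β v ω).toReal / c) s = hitCharFun β (s / c) v := by
  have hm : Measurable fun ω : Sample N => (hitTime β v ω).toReal / c :=
    (measurable_hitTime β v).ennreal_toReal.div_const c
  rw [charFun_apply_real, integral_map hm.aemeasurable (by fun_prop), hitCharFun]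
  refine integral_congr_ae (.of_forall fun ω => ?_)
  simp only
  push_cast
  ring_nf

end SocialNetwork

theorem theorem3 (N : ℕ) [NeZero N] (hN : 3 ≤ N) (v : SocialNetwork.PressureList N)
    (hv : v ∈ SocialNetwork.positiveConsensus N) :
    (∀ β : ℝ, 0 ≤ β →
      0 < SocialNetwork.meanReachingTime β v (SocialNetwork.negativeConsensus N) ∧
      SocialNetwork.meanReachingTime β v (SocialNetwork.negativeConsensus N) < ∞) ∧
    TendstoInDistribution
      (fun (β : ℝ) (ω : SocialNetwork.Sample N) =>
        (SocialNetwork.reachingTime β v (SocialNetwork.negativeConsensus N) ω).toReal /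
          (SocialNetwork.meanReachingTime β v (SocialNetwork.negativeConsensus N)).toReal)
      atTop (id : ℝ → ℝ) (fun _ => SocialNetwork.law N) (expMeasure 1) := by
  open SocialNetwork in
  have hN2 : 2 ≤ N := by omega
  have hvn : v ∉ negativeConsensus N := notMem_negativeConsensus hv.2.2
  have hmean : ∀ β : ℝ, meanReachingTime β v (negativeConsensus N) = meanHitTime β v := fun β =>
    lintegral_congr_ae (reachingTime_ae_eq hvn)
  have hpos : ∀ β : ℝ, 0 ≤ β → 0 < (meanHitTime β v).toReal := fun β hβ =>
    (isHittingMean hN2 hβ).pos hvn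
  have hratio : ∀ β : ℝ, (fun ω => (reachingTime β v (negativeConsensus N) ω).toReal /
      (meanReachingTime β v (negativeConsensus N)).toReal) =ᵐ[law N]
      fun ω => (hitTime β v ω).toReal / (meanHitTime β v).toReal := fun β => by
    filter_upwards [reachingTime_ae_eq (β := β) hvn] with ω hω
    rw [hω, hmean]
  refine ⟨fun β hβ => ?_, ?_⟩
  · rw [hmean]
    exact ⟨(ENNReal.toReal_pos_iff.1 (hpos β hβ)).1, (ENNReal.toReal_pos_iff.1 (hpos β hβ)).2⟩
  have hmeas : ∀ β : ℝ, Measurable fun ω : Sample N =>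
      (hitTime β v ω).toReal / (meanHitTime β v).toReal := fun β =>
    (measurable_hitTime β v).ennreal_toReal.div_const _
  have haem : ∀ β : ℝ, AEMeasurable (fun ω =>
      (reachingTime β v (negativeConsensus N) ω).toReal /
        (meanReachingTime β v (negativeConsensus N)).toReal) (law N) := fun β =>
    ⟨_, hmeas β, hratio β⟩
  refine ⟨haem, aemeasurable_id, ?_⟩
  refine tendsto_of_seq_tendsto fun x hx => ?_
  refine ProbabilityMeasure.tendsto_iff_tendsto_charFun.2 fun s => ?_
  have hlim := tendsto_hittingCharFun hN hv
    (h := fun β w => (meanHitTime β w).toReal) (fun β hβ => isHittingMean hN2 hβ) s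
    (f := fun β => hitCharFun β (s / (meanHitTime β v).toReal))
    (fun β hβ => isHittingCharFun hN2 hβ _)
  have hexp : charFun (expMeasure 1) s = 1 / (1 - s * Complex.I) := by
    rw [charFun_apply_real]
    exact_mod_cast integral_exp_expMeasure one_pos s
  simp only [ProbabilityMeasure.coe_mk, Measure.map_id, hexp]
  refine (hlim.comp hx).congr fun n => ?_
  exact (charFun_map_div_mean (x n) v _ s).symm.trans
    (congrArg (charFun · s) (Measure.map_congr (hratio (x n)).symm))
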